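/- Let $\mathfrak g$ be a finite-dimensional simple complex Lie algebra with Cartan subalgebra $\mathfrak h$, root system $R$, a choice of simple roots $\Gamma$, and highest root $\alpha_{\max}$; write $\mathfrak g_\beta$ for the root space of $\beta\in R$. Let $\alpha\in\Gamma$ and let $k$ be the coefficient of $\alpha$ in $\alpha_{\max}$. Let $c_1\neq c_2$ be non-zero complex numbers and $a(u)=\dfrac{1}{(1-c_1u)(1-c_2u)}$. Notation. On $\mathfrak g((u))$ put $Q_{a(u)}(f,g)=\mathrm{Res}_{u=0}\bigl(a(u)K(f,g)\bigr)$, where $K$ is the Killing form of $\mathfrak g((u))$ over $\mathbb C((u))$. On $\mathfrak g\oplus\mathfrak g$ put $\bar Q((x_1,y_1),(x_2,y_2))=K(x_1,x_2)-K(y_1,y_2)$, where $K$ is the Killing form of $\mathfrak g$. A complex Lie subalgebra is called Lagrangian if it equals its own orthogonal complement, and two subspaces are called transversal if the ambient space is their direct sum. Let $h\in\mathfrak h$ be the element with $\alpha(h)=1/k$ and $\alpha'(h)=0$ for every $\alpha'\in\Gamma\setminus\{\alpha\}$, and let $$\mathbb O_\alpha=\mathfrak h[[u^{-1}]]\oplus\bigoplus_{\beta\in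 R}\{f\in\mathbb C((u^{-1})):v(f)\ge\beta(h)\}\otimes\mathfrak g_\beta\subseteq\mathfrak g((u^{-1})),\qquad v\Bigl(\sum_{m\ge n}a_mu^{-m}\Bigr)=n\ \text{ if } a_n\neq0,\qquad v(0)=\infty .$$ Let $\mathfrak g_0$ be the sum of $\mathfrak h$ and all $\mathfrak g_\beta$ such that $\beta$ does not contain $\alpha$, let $\mathfrak n_\alpha^-$ be the sum of all $\mathfrak g_\beta$ such that $\beta$ is negative and contains $\alpha$, and let $P_\alpha^-=\mathfrak g_0\oplus\mathfrak n_\alpha^-$. Let $\Delta_\alpha$ be the set of pairs $(x,y)\in P_\alpha^-\times P_\alpha^-$ whose components in $\mathfrak g_0$ coincide. (i) If $k=1$, then $W\mapsto\{(w|_{u^{-1}=c_1},\,w|_{u^{-1}=c_2}) : w\in W\}$ is a bijection from the set of Lagrangian subalgebras $W$ of $\mathfrak g((u))$ (with respect to $Q_{a(u)}$) that are transversal to $\mathfrak g[[u]]$ and satisfy $W\subseteq\mathbb O_\alpha\cap\mathfrak g[u,u^{-1}]$ onto the set of Lagrangian subalgebras of $\mathfrak g\oplus\mathfrak g$ (with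 respect to $\bar Q$) that are transversal to $\Delta_\alpha$. (ii) If $k>1$, then there is no Lagrangian subalgebra $W$ of $\mathfrak g((u))$ (with respect to $Q_{a(u)}$) that is transversal to $\mathfrak g[[u]]$ and satisfies $W\subseteq\mathbb O_\alpha\cap\mathfrak g[u,u^{-1}]$. -/

import Mathlib

open scoped TensorProduct LaurentPolynomial

noncomputable section

namespace LoopLagrangian

/-! ### Simple roots, the highest root, the parabolic subalgebra and the space of pairs -/

section Roots

variable {𝔤 : Type*} [LieRing 𝔤] [LieAlgebra ℂ 𝔤] [FiniteDimensional ℂ 𝔤]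
  [LieAlgebra.IsKilling ℂ 𝔤] {H : LieSubalgebra ℂ 𝔤} [H.IsCartanSubalgebra]

/-- The integer coefficient of the simple root `α` in the decomposition of the root `β` with respect
to the base `b`. -/
def coeffSimple (b : (LieAlgebra.IsKilling.rootSystem H).Base) (α : b.support) (β : H.root) : ℤ :=
  b.toWeightBasisInt.repr ((LieAlgebra.IsKilling.rootSystem H).rootSpanMem ℤ β) α

/-- `θ` is the highest root `α_max`: for every root `β`, the difference `θ - β` is a combination of
simple roots with nonnegative coefficients. -/
def IsHighestRoot (b : (LieAlgebra.IsKilling.rootSystem H).Base) (θ : H.root) : Prop :=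
  ∀ (β : H.root) (α : b.support), coeffSimple b α β ≤ coeffSimple b α θ

/-- The vertex of the standard simplex that corresponds to the simple root `α`, when the coefficient
of `α` in the highest root is `k`: the element `h` of the Cartan subalgebra at which `α` takes the
value `1 / k` and all other simple roots vanish (see `simpleRoot_vertex`). -/
def vertex (b : (LieAlgebra.IsKilling.rootSystem H).Base) (α : b.support) (k : ℤ) : H :=
  (k : ℂ)⁻¹ • (Module.evalEquiv ℂ H).symm (b.toWeightBasis.coord α)

theorem simpleRoot_vertex (b : (LieAlgebra.IsKilling.rootSystem H).Base) (α : b.support) (k : ℤ) :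
    (LieAlgebra.IsKilling.rootSystem H).root α (vertex b α k) = 1 / (k : ℂ) ∧
      ∀ β : b.support, β ≠ α →
        (LieAlgebra.IsKilling.rootSystem H).root β (vertex b α k) = 0 := by
  have h (β : b.support) : (LieAlgebra.IsKilling.rootSystem H).root β (vertex b α k) =
      (k : ℂ)⁻¹ * Finsupp.single β 1 α := by
    have h' := Module.apply_evalEquiv_symm_apply (R := ℂ) (M := H)
      ((LieAlgebra.IsKilling.rootSystem H).root β) (b.toWeightBasis.coord α)
    rw [vertex, map_smul, h', Module.Basis.coord_apply, b.toWeightBasis_repr_root, smul_eq_mul]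
  refine ⟨by rw [h, Finsupp.single_eq_same, mul_one, one_div], fun β hβ => ?_⟩
  rw [h, Finsupp.single_eq_of_ne (Ne.symm hβ), mul_zero]

/-- The sum of the root spaces of the roots in a set `S`. -/
def rootSum (S : Set H.root) : Submodule ℂ 𝔤 :=
  ⨆ β ∈ S, (LieAlgebra.rootSpace H (β : LieModule.Weight ℂ H 𝔤)).toSubmodule

/-- The standard parabolic subalgebra `P_α⁻`: the Cartan subalgebra and the root spaces of all
negative roots and of all positive roots that do not contain `α`. -/
def parabolic (b : (LieAlgebra.IsKilling.rootSystem H).Base) (α : b.support) : Submodule ℂ 𝔤 :=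
  H.toSubmodule ⊔ rootSum {β | ¬ b.IsPos β ∨ (b.IsPos β ∧ coeffSimple b α β = 0)}

/-- The reductive part of `P_α⁻`: the Cartan subalgebra and the root spaces of all roots that do not
contain `α`. -/
def levi (b : (LieAlgebra.IsKilling.rootSystem H).Base) (α : b.support) : Submodule ℂ 𝔤 :=
  H.toSubmodule ⊔ rootSum {β | coeffSimple b α β = 0}

/-- The nilpotent radical of `P_α⁻`: the root spaces of all negative roots that contain `α`. -/
def nilradical (b : (LieAlgebra.IsKilling.rootSystem H).Base) (α : b.support) : Submodule ℂ 𝔤 :=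
  rootSum {β | coeffSimple b α β < 0}

/-- `Δ_α`: the pairs of elements of `P_α⁻` that have the same reductive part. -/
def equalReductivePart (b : (LieAlgebra.IsKilling.rootSystem H).Base) (α : b.support) :
    Submodule ℂ (𝔤 × 𝔤) where
  carrier := {p | p.1 ∈ parabolic b α ∧ p.2 ∈ parabolic b α ∧
    ∃ z ∈ levi b α, p.1 - z ∈ nilradical b α ∧ p.2 - z ∈ nilradical b α}
  zero_mem' := ⟨zero_mem _, zero_mem _, 0, zero_mem _, by simp, by simp⟩
  add_mem' := by
    rintro p q ⟨hp1, hp2, z, hz, hz1, hz2⟩ ⟨hq1, hq2, w, hw, hw1, hw2⟩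
    refine ⟨add_mem hp1 hq1, add_mem hp2 hq2, z + w, add_mem hz hw, ?_, ?_⟩
    · rw [Prod.fst_add, add_sub_add_comm]; exact add_mem hz1 hw1
    · rw [Prod.snd_add, add_sub_add_comm]; exact add_mem hz2 hw2
  smul_mem' := by
    rintro c p ⟨hp1, hp2, z, hz, hz1, hz2⟩
    refine ⟨Submodule.smul_mem _ c hp1, Submodule.smul_mem _ c hp2, c • z,
      Submodule.smul_mem _ c hz, ?_, ?_⟩
    · rw [Prod.smul_fst, ← smul_sub]; exact Submodule.smul_mem _ c hz1
    · rw [Prod.smul_snd, ← smul_sub]; exact Submodule.smul_mem _ c hz2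

end Roots

/-! ### Loop algebras -/

/-- The field `K((t))` of formal Laurent series. -/
abbrev Laurent (K : Type*) [Field K] : Type _ := LaurentSeries K

/-- `K((t))` as a `K`-algebra, with the coefficientwise scalar multiplication. (It is named here only
so that it takes precedence over other, propositionally equal, instances.) -/
instance laurentAlgebra (K : Type*) [Field K] : Algebra K (Laurent K) := HahnSeries.instAlgebra

/-- `𝔤((t)) = K((t)) ⊗ 𝔤`, for a finite dimensional Lie algebra `𝔤`. It serves both as `𝔤((u))` (with
`t = u`) and as `𝔤((u⁻¹))` (with `t = u⁻¹`). -/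
abbrev Formal (K 𝔤 : Type*) [Field K] [LieRing 𝔤] [LieAlgebra K 𝔤] : Type _ := Laurent K ⊗[K] 𝔤

/-- `𝔤[u, u⁻¹]`. -/
abbrev Loop (K 𝔤 : Type*) [Field K] [LieRing 𝔤] [LieAlgebra K 𝔤] : Type _ := K[T;T⁻¹] ⊗[K] 𝔤

/-- The variable `t` of `K((t))`, as an invertible element. -/
def laurentVar (K : Type*) [Field K] : (Laurent K)ˣ :=
  Units.mk0 (HahnSeries.single (1 : ℤ) (1 : K)) (by simp)

/-- The homomorphism `K[u, u⁻¹] → A` that sends `u` to the invertible element `x`. -/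
def laurentSubst {K A : Type*} [Field K] [CommRing A] [Algebra K A] (x : Aˣ) : K[T;T⁻¹] →ₐ[K] A :=
  AddMonoidAlgebra.lift K A ℤ ((Units.coeHom A).comp (zpowersHom Aˣ x))

theorem laurentSubst_T {K A : Type*} [Field K] [CommRing A] [Algebra K A] (x : Aˣ) (n : ℤ) :
    laurentSubst (K := K) x (LaurentPolynomial.T n) = ((x ^ n : Aˣ) : A) := by
  rw [laurentSubst, LaurentPolynomial.T, AddMonoidAlgebra.lift_single]
  simp

section Loops

variable (K 𝔤 : Type*) [Field K] [LieRing 𝔤] [LieAlgebra K 𝔤]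

/-- The embedding `𝔤[u, u⁻¹] → 𝔤((u))`. -/
def toFormalZero : Loop K 𝔤 →ₗ⁅K⁆ Formal K 𝔤 :=
  LieAlgebra.ExtendScalars.map (laurentSubst (laurentVar K)) LieHom.id

/-- The embedding `𝔤[u, u⁻¹] → 𝔤((u⁻¹))`: here the variable of the Laurent series is `u⁻¹`. -/
def toFormalInfty : Loop K 𝔤 →ₗ⁅K⁆ Formal K 𝔤 :=
  LieAlgebra.ExtendScalars.map (laurentSubst (laurentVar K)⁻¹) LieHom.id

/-- The canonical isomorphism `K ⊗ 𝔤 → 𝔤`, `a ⊗ x ↦ a • x`, as a homomorphism of Lie algebras. -/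
def lidHom : K ⊗[K] 𝔤 →ₗ⁅K⁆ 𝔤 where
  toLinearMap := (TensorProduct.lid K 𝔤).toLinearMap
  map_lie' := by
    intro x y
    induction x using TensorProduct.induction_on with
    | zero => simp
    | add x₁ x₂ h₁ h₂ => simp_all
    | tmul a x =>
      induction y using TensorProduct.induction_on with
      | zero => simp
      | add y₁ y₂ h₁ h₂ => simp_all
      | tmul b y =>
        change (a * b) • ⁅x, y⁆ = ⁅a • x, b • y⁆
        rw [smul_lie, lie_smul, mul_smul]

/-- Evaluation `𝔤[u, u⁻¹] → 𝔤` at `u⁻¹ = c`, that is, at `u = c⁻¹`. -/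
def evalAt (c : Kˣ) : Loop K 𝔤 →ₗ⁅K⁆ 𝔤 :=
  (lidHom K 𝔤).comp (LieAlgebra.ExtendScalars.map (laurentSubst c⁻¹) LieHom.id)

theorem evalAt_T (c : Kˣ) (n : ℤ) (x : 𝔤) :
    evalAt K 𝔤 c (LaurentPolynomial.T n ⊗ₜ[K] x) = ((c : K) ^ (-n)) • x := by
  have h : evalAt K 𝔤 c (LaurentPolynomial.T n ⊗ₜ[K] x) =
      (laurentSubst (K := K) c⁻¹ (LaurentPolynomial.T n)) • x := rfl
  rw [h, laurentSubst_T]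
  simp

/-- The map `𝔤[u, u⁻¹] → 𝔤 ⊕ 𝔤` that evaluates at `u⁻¹ = c₁` and at `u⁻¹ = c₂`. -/
def evalPair (c₁ c₂ : Kˣ) : Loop K 𝔤 →ₗ⁅K⁆ 𝔤 × 𝔤 :=
  (evalAt K 𝔤 c₁).prod (evalAt K 𝔤 c₂)

end Loops

/-! ### Valuations, Taylor series and maximal orders -/

/-- The Laurent series in `t` whose valuation (order at `t = 0`) is at least `r`. -/
def valuationGE (K : Type*) [Field K] (r : ℝ) : Submodule K (Laurent K) where
  carrier := {f | ∀ n : ℤ, (n : ℝ) < r → f.coeff n = 0}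
  zero_mem' := fun _ _ => rfl
  add_mem' := fun hf hg n hn => by rw [HahnSeries.coeff_add, hf n hn, hg n hn, add_zero]
  smul_mem' := fun c f hf n hn => by
    rw [HahnSeries.coeff_smul, hf n hn, smul_zero]

/-- The subspace of `𝔤((t))` spanned by the elements `f ⊗ x` with `f ∈ M` and `x ∈ V`. -/
def tensorSpan {K 𝔤 : Type*} [Field K] [LieRing 𝔤] [LieAlgebra K 𝔤]
    (M : Submodule K (Laurent K)) (V : Submodule K 𝔤) : Submodule K (Formal K 𝔤) :=
  Submodule.map₂ (TensorProduct.mk K (Laurent K) 𝔤) M V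

/-- `𝔤[[u]]` inside `𝔤((u))`. -/
def taylor (K 𝔤 : Type*) [Field K] [LieRing 𝔤] [LieAlgebra K 𝔤] : Submodule K (Formal K 𝔤) :=
  tensorSpan (valuationGE K 0) ⊤

section Orders

variable {𝔤 : Type*} [LieRing 𝔤] [LieAlgebra ℂ 𝔤] [FiniteDimensional ℂ 𝔤]
  [LieAlgebra.IsKilling ℂ 𝔤] {H : LieSubalgebra ℂ 𝔤} [H.IsCartanSubalgebra]

/-- The order `𝕆_h ⊆ 𝔤((u⁻¹))`, where `h` is an element of the Cartan subalgebra at which all roots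
take real values: `𝔥[[u⁻¹]] ⊕ ⨁ M_β(h) ⊗ 𝔤_β`, where `M_β(h)` consists of the `f ∈ ℂ((u⁻¹))` of
valuation at least `β(h)`. -/
def maximalOrder (h : H) : Submodule ℂ (Formal ℂ 𝔤) :=
  tensorSpan (valuationGE ℂ 0) H.toSubmodule ⊔
    ⨆ β : H.root, tensorSpan
      (valuationGE ℂ ((LieAlgebra.IsKilling.rootSystem H).root β h).re)
      (LieAlgebra.rootSpace H (β : LieModule.Weight ℂ H 𝔤)).toSubmodule

/-- `𝕆_h ∩ 𝔤[u, u⁻¹]`, regarded as a subspace of `𝔤((u))`. -/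
def orderLoops (h : H) : Submodule ℂ (Formal ℂ 𝔤) :=
  ((maximalOrder h).comap (toFormalInfty ℂ 𝔤).toLinearMap).map (toFormalZero ℂ 𝔤).toLinearMap

end Orders

/-! ### Bilinear forms and Lagrangian subalgebras -/

/-- The series `a(u) = 1 / ((1 - c₁ u) (1 - c₂ u))`; the inverse is taken in the field `K((u))`. -/
def aSeries {K : Type*} [Field K] (c₁ c₂ : K) : Laurent K :=
  ((1 - HahnSeries.single (1 : ℤ) c₁) * (1 - HahnSeries.single (1 : ℤ) c₂))⁻¹

section Forms

variable {K : Type*} [Field K] (𝔤 : Type*) [LieRing 𝔤] [LieAlgebra K 𝔤]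

/-- The form `Q_a(f, g) = Res_{u = 0} (a(u) κ(f, g))` on `𝔤((u))`, where `κ` is the Killing form of
the Lie algebra `𝔤((u))` over the field `K((u))`. -/
def residueForm (a : Laurent K) : LinearMap.BilinForm K (Formal K 𝔤) :=
  LinearMap.mk₂ K
    (fun f g => HahnSeries.coeff (a * killingForm (Laurent K) (Formal K 𝔤) f g) (-1))
    (fun f f' g => by rw [map_add, LinearMap.add_apply, mul_add, HahnSeries.coeff_add])
    (fun c f g => by
      rw [LinearMap.map_smul_of_tower, LinearMap.smul_apply, mul_smul_comm, HahnSeries.coeff_smul])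
    (fun f g g' => by rw [map_add, mul_add, HahnSeries.coeff_add])
    (fun c f g => by
      rw [LinearMap.map_smul_of_tower, mul_smul_comm, HahnSeries.coeff_smul])

variable (K) in
/-- The form `Q̄((x₁, y₁), (x₂, y₂)) = κ(x₁, x₂) - κ(y₁, y₂)` on `𝔤 ⊕ 𝔤`, where `κ` is the Killing
form of `𝔤`. -/
def pairForm : LinearMap.BilinForm K (𝔤 × 𝔤) :=
  (killingForm K 𝔤).compl₁₂ (LinearMap.fst K 𝔤 𝔤) (LinearMap.fst K 𝔤 𝔤) -
    (killingForm K 𝔤).compl₁₂ (LinearMap.snd K 𝔤 𝔤) (LinearMap.snd K 𝔤 𝔤)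

end Forms

section Lagrangian

variable {K L : Type*} [Field K] [LieRing L] [LieAlgebra K L]

/-- A subalgebra `W` is Lagrangian for the form `B` if it equals its own orthogonal complement. -/
def IsLagrangian (B : LinearMap.BilinForm K L) (W : LieSubalgebra K L) : Prop :=
  B.orthogonal W.toSubmodule = W.toSubmodule

/-- The Lagrangian subalgebras of `L` with respect to `B` that are transversal to the subspace `V`,
that is, complementary to it. -/
def transversalLagrangians (B : LinearMap.BilinForm K L) (V : Submodule K L) :
    Set (LieSubalgebra K L) :=
  {W | IsLagrangian B W ∧ IsCompl W.toSubmodule V}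

end Lagrangian

end LoopLagrangian

end

open scoped TensorProduct LaurentPolynomial

noncomputable section

namespace LoopLagrangian

/-! ### Lagrangian reduction along a coisotropic subalgebra -/

section Reduction

/-! Let `D` be `𝕆_α ∩ 𝔤[u, u⁻¹]`, and filter `𝔤` by `F_r`, the sum of the weight spaces whose weight
has real part at most `r` at `h`. Then `D` consists of the loops whose coefficient of `u ^ n` lies
in `F_(-n)` (`orderLoops_eq`). Since `F_r` and `F_s` are Killing orthogonal when `r + s < 0`, `κ(f,
g)` is a polynomial in `u⁻¹` for `f`, `g` in `D`. The residue theorem then gives `Q = (c₁ - c₂)⁻¹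
Q̄` after evaluation at the two poles (`residueForm_eq_pairForm`).

Put `p = (u⁻¹ - c₁)(u⁻¹ - c₂)`. As `a(u) p = u ^ (-2)`, pairing with `p u ^ n x` extracts the single
number `κ(x, f_(1-n))` (`residueForm_shiftedLoop`).

If `k = 1`, all roots are integers in `{-1, 0, 1}` at `h`, so the Killing complement of `F_(n-1)`
lies in `F_(-n)`. Hence whatever is orthogonal to the kernel of the evaluation on `D` is already in
`D`: `D` is coisotropic. Evaluation maps `D` onto `𝔤 ⊕ 𝔤`, `D + 𝔤[[u]]` is everything, and `D ∩
𝔤[[u]] = P_α⁻ + u 𝔫_α⁻` is carried isomorphically onto `Δ_α`. The bijection is then formal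
(`bijOn_transversalLagrangians`).

If `k > 1`, the value `α(h) = 1/k` lies strictly between `0` and `1`. For `x` in `𝔤_α`, the loop `p
x` is orthogonal to `D`, so it lies in every Lagrangian `W ⊆ D`; but its constant coefficient `c₁ c₂
x` is not in `F_0`, so it is not in `D`. -/

theorem mem_iff_of_isLagrangian {K L : Type*} [Field K] [LieRing L] [LieAlgebra K L]
    {B : LinearMap.BilinForm K L} {W : LieSubalgebra K L} (h : IsLagrangian B W) (x : L) :
    x ∈ W ↔ ∀ w ∈ W, B w x = 0 :=
  (SetLike.ext_iff.1 h x).symm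

variable {K A L M : Type*} [Field K] [LieRing A] [LieAlgebra K A] [LieRing L] [LieAlgebra K L]
  [LieRing M] [LieAlgebra K M]

/-- Lagrangian reduction: let `D` be a coisotropic subalgebra of `L` (given as a subalgebra of `A`,
where `A` embeds in `L` by `ι`) on which the form is, up to a nonzero factor, the pullback of the
form on `M` under the surjection `e : D → M`. Then the Lagrangian subalgebras of `L` inside `D` that
are transversal to `T` correspond to the Lagrangian subalgebras of `M` that are transversal to the
image `Δ` of `D ∩ T`, provided that `D + T = L` and that `e` is injective on `D ∩ T`. -/
theorem bijOn_transversalLagrangians (ι : A →ₗ⁅K⁆ L) (hι : Function.Injective ι) (e : A →ₗ⁅K⁆ M)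
    (D : LieSubalgebra K A) (Q : LinearMap.BilinForm K L) (Q' : LinearMap.BilinForm K M)
    {c : K} (hc : c ≠ 0) (T : Submodule K L) (Δ : Submodule K M)
    (hQ : ∀ d ∈ D, ∀ d' ∈ D, Q (ι d) (ι d') = c * Q' (e d) (e d'))
    (hsurj : ∀ m, ∃ d ∈ D, e d = m)
    (hcoiso : ∀ x, (∀ d ∈ D, e d = 0 → Q (ι d) x = 0) → ∃ d ∈ D, ι d = x)
    (hsup : ∀ x, ∃ d ∈ D, x - ι d ∈ T)
    (hΔ : ∀ m, m ∈ Δ ↔ ∃ d ∈ D, ι d ∈ T ∧ e d = m)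
    (hinj : ∀ d ∈ D, ι d ∈ T → e d = 0 → d = 0) :
    Set.BijOn (fun W : LieSubalgebra K L => (W.comap ι).map e)
      {W | W ∈ transversalLagrangians Q T ∧ W.toSubmodule ≤ D.toSubmodule.map ι.toLinearMap}
      (transversalLagrangians Q' Δ) := by
  have mem_image (W : LieSubalgebra K L) (m : M) :
      m ∈ (W.comap ι).map e ↔ ∃ d, ι d ∈ W ∧ e d = m := by
    simp [LieSubalgebra.mem_map]
  have lift {W : LieSubalgebra K L} (h : W.toSubmodule ≤ D.toSubmodule.map ι.toLinearMap) {x : L}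
      (hx : x ∈ W) : ∃ d ∈ D, ι d = x := h hx
  have mem_D {W : LieSubalgebra K L} (h : W.toSubmodule ≤ D.toSubmodule.map ι.toLinearMap) {d : A}
      (hd : ι d ∈ W) : d ∈ D := by
    obtain ⟨d', hd', h'⟩ := lift h hd
    rwa [← hι h']
  -- The kernel of `e` on `D` is orthogonal to `D`, hence to `W`, so it lies in `W^⊥ = W`.
  have ker_mem {W : LieSubalgebra K L} (hW : IsLagrangian Q W)
      (h : W.toSubmodule ≤ D.toSubmodule.map ι.toLinearMap) {d : A} (hd : d ∈ D) (hd0 : e d = 0) :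
      ι d ∈ W := by
    rw [mem_iff_of_isLagrangian hW]
    intro w hw
    obtain ⟨d', hd', rfl⟩ := lift h hw
    rw [hQ d' hd' d hd, hd0, map_zero, mul_zero]
  -- Containing that kernel, `W` is the full preimage in `D` of its image; this gives injectivity.
  have mem_iff {W : LieSubalgebra K L} (hW : IsLagrangian Q W)
      (h : W.toSubmodule ≤ D.toSubmodule.map ι.toLinearMap) {d : A} (hd : d ∈ D) :
      ι d ∈ W ↔ e d ∈ (W.comap ι).map e := by
    rw [mem_image]
    refine ⟨fun h' => ⟨d, h', rfl⟩, ?_⟩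
    rintro ⟨d', hd', h'⟩
    have h0 := ker_mem hW h (sub_mem hd (mem_D h hd')) (by rw [map_sub, h', sub_self])
    simpa using add_mem h0 hd'
  refine ⟨?_, ?_, ?_⟩
  · rintro W ⟨⟨hW, hWT⟩, hWD⟩
    refine ⟨?_, ?_, ?_⟩
    · ext m
      obtain ⟨d, hd, rfl⟩ := hsurj m
      change (∀ n ∈ (W.comap ι).map e, Q' n (e d) = 0) ↔ e d ∈ (W.comap ι).map e
      rw [← mem_iff hW hWD hd, mem_iff_of_isLagrangian hW]
      constructor
      · intro h w hw
        obtain ⟨d', hd', rfl⟩ := lift hWD hw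
        rw [hQ d' hd' d hd, h _ ((mem_image _ _).2 ⟨d', hw, rfl⟩), mul_zero]
      · intro h n hn
        obtain ⟨d', hd', rfl⟩ := (mem_image _ _).1 hn
        have := h _ hd'
        rw [hQ d' (mem_D hWD hd') d hd] at this
        exact (mul_eq_zero.1 this).resolve_left hc
    · rw [Submodule.disjoint_def]
      intro m hm hmΔ
      obtain ⟨d, hd, hdT, rfl⟩ := (hΔ m).1 hmΔ
      have h1 : ι d ∈ W := (mem_iff hW hWD hd).2 hm
      have h0 := Submodule.disjoint_def.1 hWT.disjoint _ h1 hdT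
      rw [(map_eq_zero_iff ι hι).1 h0, map_zero]
    · rw [codisjoint_iff, eq_top_iff]
      rintro m -
      obtain ⟨d, hd, rfl⟩ := hsurj m
      have h1 : ι d ∈ W.toSubmodule ⊔ T := by rw [hWT.sup_eq_top]; trivial
      obtain ⟨w, hw, t, ht, hwt⟩ := Submodule.mem_sup.1 h1
      obtain ⟨d', hd', rfl⟩ := lift hWD hw
      have h2 : ι (d - d') = t := by rw [map_sub, ← hwt, add_sub_cancel_left]
      refine Submodule.mem_sup.2 ⟨e d', (mem_iff hW hWD hd').1 hw, e (d - d'),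
        (hΔ _).2 ⟨d - d', sub_mem hd hd', by rwa [h2], rfl⟩, ?_⟩
      rw [map_sub, add_sub_cancel]
  · rintro W₁ ⟨⟨hW₁, -⟩, hD₁⟩ W₂ ⟨⟨hW₂, -⟩, hD₂⟩ h
    simp only at h
    ext x
    constructor
    · intro hx
      obtain ⟨d, hd, rfl⟩ := lift hD₁ hx
      rwa [mem_iff hW₂ hD₂ hd, ← h, ← mem_iff hW₁ hD₁ hd]
    · intro hx
      obtain ⟨d, hd, rfl⟩ := lift hD₂ hx
      rwa [mem_iff hW₁ hD₁ hd, h, ← mem_iff hW₂ hD₂ hd]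
  · rintro U ⟨hU, hUΔ⟩
    have mem_W (x : L) : x ∈ (U.comap e ⊓ D).map ι ↔ ∃ d ∈ D, e d ∈ U ∧ ι d = x := by
      simp only [LieSubalgebra.mem_map, LieSubalgebra.mem_inf, LieSubalgebra.mem_comap]
      constructor
      · rintro ⟨d, ⟨h1, h2⟩, h3⟩
        exact ⟨d, h2, h1, h3⟩
      · rintro ⟨d, h1, h2, h3⟩
        exact ⟨d, ⟨h2, h1⟩, h3⟩
    -- The inverse sends `U` to its full preimage in `D`. This preimage contains the kernel of `e`
    -- on `D`, so coisotropy confines its orthogonal complement to `D`.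
    refine ⟨(U.comap e ⊓ D).map ι, ⟨⟨?_, ?_, ?_⟩, ?_⟩, ?_⟩
    · ext x
      change (∀ w ∈ (U.comap e ⊓ D).map ι, Q w x = 0) ↔ x ∈ (U.comap e ⊓ D).map ι
      constructor
      · intro h
        obtain ⟨d, hd, rfl⟩ := hcoiso x fun d hd hd0 =>
          h _ ((mem_W _).2 ⟨d, hd, by rw [hd0]; exact zero_mem _, rfl⟩)
        refine (mem_W _).2 ⟨d, hd, ?_, rfl⟩
        rw [mem_iff_of_isLagrangian hU]
        intro u hu
        obtain ⟨d', hd', rfl⟩ := hsurj u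
        have := h _ ((mem_W _).2 ⟨d', hd', hu, rfl⟩)
        rw [hQ d' hd' d hd] at this
        exact (mul_eq_zero.1 this).resolve_left hc
      · intro hx w hw
        obtain ⟨d, hd, hdU, rfl⟩ := (mem_W _).1 hx
        obtain ⟨d', hd', hdU', rfl⟩ := (mem_W _).1 hw
        rw [hQ d' hd' d hd, (mem_iff_of_isLagrangian hU _).1 hdU _ hdU', mul_zero]
    · rw [Submodule.disjoint_def]
      intro x hx hxT
      obtain ⟨d, hd, hdU, rfl⟩ := (mem_W _).1 hx
      have h0 := Submodule.disjoint_def.1 hUΔ.disjoint _ hdU ((hΔ _).2 ⟨d, hd, hxT, rfl⟩)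
      rw [hinj d hd hxT h0, map_zero]
    · rw [codisjoint_iff, eq_top_iff]
      rintro x -
      obtain ⟨d, hd, hdT⟩ := hsup x
      have h1 : e d ∈ U.toSubmodule ⊔ Δ := by rw [hUΔ.sup_eq_top]; trivial
      obtain ⟨u, hu, m, hm, hum⟩ := Submodule.mem_sup.1 h1
      obtain ⟨d', hd', hT', rfl⟩ := (hΔ m).1 hm
      refine Submodule.mem_sup.2 ⟨ι (d - d'), (mem_W _).2 ⟨d - d', sub_mem hd hd', ?_, rfl⟩,
        ι d' + (x - ι d), add_mem hT' hdT, ?_⟩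
      · rwa [map_sub, ← hum, add_sub_cancel_right]
      · rw [map_sub]; abel
    · intro x hx
      obtain ⟨d, hd, -, rfl⟩ := (mem_W _).1 hx
      exact ⟨d, hd, rfl⟩
    · ext m
      rw [mem_image]
      constructor
      · rintro ⟨d, hd, rfl⟩
        obtain ⟨d', hd', hU', h'⟩ := (mem_W _).1 hd
        rwa [← hι h']
      · intro hm
        obtain ⟨d, hd, rfl⟩ := hsurj m
        exact ⟨d, (mem_W _).2 ⟨d, hd, hm, rfl⟩, rfl⟩

end Reduction

/-! ### Weight spaces, the filtration at a point of the Cartan subalgebra, and the vertex -/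

section Weights

set_option linter.unusedSectionVars false

open LieAlgebra

variable {𝔤 : Type*} [LieRing 𝔤] [LieAlgebra ℂ 𝔤] [FiniteDimensional ℂ 𝔤]
  [LieAlgebra.IsKilling ℂ 𝔤] {H : LieSubalgebra ℂ 𝔤} [H.IsCartanSubalgebra]

/-- The sum of the weight spaces of the weights in a set `S`. -/
def weightSum (S : Set (H → ℂ)) : Submodule ℂ 𝔤 :=
  ⨆ χ ∈ S, (rootSpace H χ).toSubmodule

theorem rootSpace_le_weightSum {S : Set (H → ℂ)} {χ : H → ℂ} (hχ : χ ∈ S) :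
    (rootSpace H χ).toSubmodule ≤ weightSum S :=
  le_biSup (fun χ : H → ℂ => (rootSpace H χ).toSubmodule) hχ

theorem weightSum_induction {S : Set (H → ℂ)} {p : 𝔤 → Prop} {x : 𝔤} (hx : x ∈ weightSum S)
    (mem : ∀ χ ∈ S, ∀ y ∈ rootSpace H χ, p y) (zero : p 0)
    (add : ∀ y z, p y → p z → p (y + z)) : p x := by
  rw [weightSum, iSup_subtype'] at hx
  exact Submodule.iSup_induction _ (motive := p) hx (fun i y hy => mem i i.2 y hy) zero add

theorem weightSum_mono {S S' : Set (H → ℂ)} (h : S ⊆ S') : weightSum S ≤ weightSum S' :=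
  biSup_mono h

theorem weightSum_univ : weightSum (Set.univ : Set (H → ℂ)) = ⊤ := by
  have := LieModule.iSup_genWeightSpace_eq_top ℂ H 𝔤
  rw [← LieSubmodule.iSup_toSubmodule_eq_top] at this
  simpa [weightSum] using this

theorem weightSum_sup (S S' : Set (H → ℂ)) :
    weightSum (S ∪ S') = weightSum S ⊔ weightSum S' := by
  simp only [weightSum, iSup_union]

theorem killingForm_eq_zero_of_mem_weightSum {S S' : Set (H → ℂ)}
    (h : ∀ χ ∈ S, ∀ χ' ∈ S', χ + χ' ≠ 0) {x y : 𝔤} (hx : x ∈ weightSum S)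
    (hy : y ∈ weightSum S') : killingForm ℂ 𝔤 x y = 0 := by
  refine weightSum_induction (p := fun x => killingForm ℂ 𝔤 x y = 0) hx (fun χ hχ x hx => ?_)
    (by simp) (fun _ _ h h' => by simp [h, h'])
  refine weightSum_induction (p := fun y => killingForm ℂ 𝔤 x y = 0) hy (fun χ' hχ' y hy => ?_)
    (by simp) (fun _ _ h h' => by simp [h, h'])
  exact LieAlgebra.killingForm_apply_eq_zero_of_mem_rootSpace_of_add_ne_zero ℂ 𝔤 H hx hy
    (h χ hχ χ' hχ')

/-- Write `x = a + c`, with `a` the part whose weights have no opposite in `S'`. Then `a` is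
orthogonal to the weights in `S'`, and `c` to all the others; the hypothesis makes `c` orthogonal to
everything, and nondegeneracy kills it. -/
theorem mem_weightSum_of_forall_killingForm_eq_zero {S S' : Set (H → ℂ)}
    (h : ∀ χ, χ ∈ S ∨ -χ ∈ S') {x : 𝔤} (hx : ∀ y ∈ weightSum S', killingForm ℂ 𝔤 y x = 0) :
    x ∈ weightSum S := by
  -- The weights whose opposite is in `S'` can be removed from a complement of `S`.
  set R : Set (H → ℂ) := {χ | -χ ∉ S'}
  have hRS : weightSum R ≤ weightSum S := weightSum_mono fun χ hχ => (h χ).resolve_right hχ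
  refine hRS ?_
  have h1 : x ∈ weightSum R ⊔ weightSum Rᶜ := by
    rw [← weightSum_sup, Set.union_compl_self, weightSum_univ]; trivial
  obtain ⟨a, ha, c, hc, rfl⟩ := Submodule.mem_sup.1 h1
  suffices c = 0 by rwa [this, add_zero]
  refine (IsKilling.killingForm_nondegenerate ℂ 𝔤).2 c fun y => ?_
  have h2 : y ∈ weightSum S' ⊔ weightSum S'ᶜ := by
    rw [← weightSum_sup, Set.union_compl_self, weightSum_univ]; trivial
  obtain ⟨y, hy, z, hz, rfl⟩ := Submodule.mem_sup.1 h2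
  have h3 : killingForm ℂ 𝔤 y a = 0 := by
    refine killingForm_eq_zero_of_mem_weightSum (fun χ hχ χ' hχ' h0 => ?_) hy ha
    refine hχ' ?_
    rwa [← eq_neg_of_add_eq_zero_left h0]
  have h4 : killingForm ℂ 𝔤 z c = 0 := by
    refine killingForm_eq_zero_of_mem_weightSum (fun χ hχ χ' hχ' h0 => ?_) hz hc
    refine hχ ?_
    rw [eq_neg_of_add_eq_zero_left h0]
    exact not_not.1 hχ'
  have h5 := hx y hy
  rw [map_add, h3, zero_add] at h5
  rw [map_add, LinearMap.add_apply, h4, h5, add_zero]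

/-- The filtration of `𝔤` by the real parts of the values of the weights at `h`. -/
def weightFiltration (h : H) (r : ℝ) : Submodule ℂ 𝔤 :=
  weightSum {χ | (χ h).re ≤ r}

theorem weightFiltration_mono (h : H) {r s : ℝ} (hrs : r ≤ s) :
    weightFiltration h r ≤ weightFiltration h s :=
  weightSum_mono fun _ hχ => le_trans hχ hrs

theorem lie_mem_weightFiltration (h : H) {r s : ℝ} {x y : 𝔤} (hx : x ∈ weightFiltration h r)
    (hy : y ∈ weightFiltration h s) : ⁅x, y⁆ ∈ weightFiltration h (r + s) := by
  refine weightSum_induction (p := fun x => ⁅x, y⁆ ∈ weightFiltration h (r + s)) hx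
    (fun χ hχ x hx => ?_) (by simp) (fun _ _ h h' => by rw [add_lie]; exact add_mem h h')
  refine weightSum_induction (p := fun y => ⁅x, y⁆ ∈ weightFiltration h (r + s)) hy
    (fun χ' hχ' y hy => ?_) (by simp) (fun _ _ h h' => by rw [lie_add]; exact add_mem h h')
  refine rootSpace_le_weightSum (χ := χ + χ') ?_
    (LieAlgebra.lie_mem_genWeightSpace_of_mem_genWeightSpace hx hy)
  simpa using add_le_add hχ hχ'

theorem killingForm_eq_zero_of_mem_weightFiltration (h : H) {r s : ℝ} (hrs : r + s < 0) {x y : 𝔤}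
    (hx : x ∈ weightFiltration h r) (hy : y ∈ weightFiltration h s) :
    killingForm ℂ 𝔤 x y = 0 := by
  refine killingForm_eq_zero_of_mem_weightSum (fun χ hχ χ' hχ' h0 => ?_) hx hy
  have h1 : (χ h).re + (χ' h).re = 0 := by
    simpa using congrArg Complex.re (congrFun h0 h)
  have h2 : (χ h).re ≤ r := hχ
  have h3 : (χ' h).re ≤ s := hχ'
  linarith

/-- Independence of weights, by way of the Killing form: the `-χ` part of any `y` is orthogonal to
`F_r` because `r < Re χ(h)`, and the rest of `y` is orthogonal to `𝔤_χ`. -/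
theorem eq_zero_of_mem_weightFiltration (h : H) {r : ℝ} {χ : H → ℂ} {x : 𝔤}
    (hx : x ∈ rootSpace H χ) (hχ : r < (χ h).re) (hr : x ∈ weightFiltration h r) : x = 0 := by
  have h0 : x ∈ weightSum (∅ : Set (H → ℂ)) := by
    refine mem_weightSum_of_forall_killingForm_eq_zero (S' := Set.univ) (by simp) fun y _ => ?_
    have h2 : y ∈ weightSum {-χ} ⊔ weightSum {-χ}ᶜ := by
      rw [← weightSum_sup, Set.union_compl_self, weightSum_univ]; trivial
    obtain ⟨y, hy, z, hz, rfl⟩ := Submodule.mem_sup.1 h2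
    have h3 : killingForm ℂ 𝔤 y x = 0 := by
      refine killingForm_eq_zero_of_mem_weightSum (fun χ₁ hχ₁ χ' hχ' h0 => ?_) hy hr
      rw [Set.mem_singleton_iff.1 hχ₁] at h0
      rw [← neg_add_eq_zero.1 h0] at hχ'
      exact absurd hχ' (not_le.2 hχ)
    have h4 : killingForm ℂ 𝔤 z x = 0 := by
      refine killingForm_eq_zero_of_mem_weightSum (S' := {χ}) (fun χ₁ hχ₁ χ' hχ' h0 => ?_) hz
        (rootSpace_le_weightSum (Set.mem_singleton χ) hx)
      refine hχ₁ ?_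
      rw [Set.mem_singleton_iff.1 hχ'] at h0
      exact eq_neg_of_add_eq_zero_left h0
    rw [map_add, LinearMap.add_apply, h3, h4, add_zero]
  simpa [weightSum] using h0

theorem rootSpace_le_weightFiltration_re (h : H) (χ : H → ℂ) :
    (rootSpace H χ).toSubmodule ≤ weightFiltration h (χ h).re :=
  rootSpace_le_weightSum (S := {χ' | (χ' h).re ≤ (χ h).re}) (le_refl (χ h).re)

theorem cartan_le_weightFiltration (h : H) {r : ℝ} (hr : 0 ≤ r) :
    H.toSubmodule ≤ weightFiltration h r := by
  have := rootSpace_le_weightSum (H := H) (S := {χ | (χ h).re ≤ r}) (χ := 0) (by simpa using hr)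
  rwa [rootSpace_zero_eq] at this

theorem rootSpace_le_weightFiltration (h : H) {r : ℝ} (β : H.root)
    (hβ : ((IsKilling.rootSystem H).root β h).re ≤ r) :
    (rootSpace H (β : LieModule.Weight ℂ H 𝔤)).toSubmodule ≤ weightFiltration h r :=
  rootSpace_le_weightSum hβ

/-- The filtration ranges over arbitrary functions `χ`; only `χ = 0`, which gives the Cartan
subalgebra, and the roots contribute. -/
theorem weightFiltration_le (h : H) {r : ℝ} {N : Submodule ℂ 𝔤}
    (hH : 0 ≤ r → H.toSubmodule ≤ N)
    (hroot : ∀ β : H.root, ((IsKilling.rootSystem H).root β h).re ≤ r →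
      (rootSpace H (β : LieModule.Weight ℂ H 𝔤)).toSubmodule ≤ N) :
    weightFiltration h r ≤ N := by
  refine iSup₂_le fun χ hχ => ?_
  by_cases h0 : χ = 0
  · subst h0
    have h1 := hH (by simpa using hχ)
    rwa [rootSpace_zero_eq]
  · by_cases hb : rootSpace H χ = ⊥
    · simp [hb]
    · let w : LieModule.Weight ℂ H 𝔤 := ⟨χ, hb⟩
      have hw : w ∈ H.root := Finset.mem_filter.2 ⟨Finset.mem_univ w, h0⟩
      exact hroot ⟨w, hw⟩ hχ

theorem rootSum_le {S : Set H.root} {N : Submodule ℂ 𝔤}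
    (h : ∀ β ∈ S, (rootSpace H (β : LieModule.Weight ℂ H 𝔤)).toSubmodule ≤ N) : rootSum S ≤ N :=
  iSup₂_le h

theorem rootSpace_le_rootSum {S : Set H.root} {β : H.root} (hβ : β ∈ S) :
    (rootSpace H (β : LieModule.Weight ℂ H 𝔤)).toSubmodule ≤ rootSum S :=
  le_biSup (fun β : H.root => (rootSpace H (β : LieModule.Weight ℂ H 𝔤)).toSubmodule) hβ

variable (b : (IsKilling.rootSystem H).Base) (α : b.support)

theorem root_vertex (k : ℤ) (β : H.root) :
    (IsKilling.rootSystem H).root β (vertex b α k) = coeffSimple b α β / k := by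
  have h1 := b.toWeightBasisInt.sum_repr ((IsKilling.rootSystem H).rootSpanMem ℤ β)
  have h2 := congrArg (fun v : (IsKilling.rootSystem H).rootSpan ℤ =>
    (v : Module.Dual ℂ H) (vertex b α k)) h1
  simp only [Submodule.coe_sum, Submodule.coe_smul, LinearMap.sum_apply] at h2
  rw [← h2, Finset.sum_eq_single α]
  · rw [LinearMap.smul_apply, RootPairing.Base.coe_toWeightBasisInt_apply,
      (simpleRoot_vertex b α k).1, zsmul_eq_mul, mul_one_div]
    rfl
  · intro γ _ hγ
    rw [LinearMap.smul_apply, RootPairing.Base.coe_toWeightBasisInt_apply,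
      (simpleRoot_vertex b α k).2 γ hγ, smul_zero]
  · simp

theorem re_root_vertex (k : ℤ) (β : H.root) :
    ((IsKilling.rootSystem H).root β (vertex b α k)).re = coeffSimple b α β / k := by
  rw [root_vertex]
  norm_cast

/-- Evaluation at the vertex with `k = 1` reads off the coefficient of `α`, and the reflection of
`β` in itself is `-β`. -/
theorem coeffSimple_reflectionPerm_self (β : H.root) :
    coeffSimple b α ((IsKilling.rootSystem H).reflectionPerm β β) = -coeffSimple b α β := by
  have h1 := root_vertex b α 1 ((IsKilling.rootSystem H).reflectionPerm β β)
  rw [RootPairing.root_reflectionPerm, RootPairing.reflection_apply_self, LinearMap.neg_apply,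
    root_vertex, Int.cast_one, div_one, div_one] at h1
  exact_mod_cast h1.symm

theorem coeffSimple_self : coeffSimple b α α = 1 := by
  have h : (IsKilling.rootSystem H).rootSpanMem ℤ α = b.toWeightBasisInt α := by
    ext1
    rw [RootPairing.Base.coe_toWeightBasisInt_apply]
  rw [coeffSimple, h, Module.Basis.repr_self, Finsupp.single_eq_same]

theorem coeffSimple_eq_of_root_eq_sum {β : H.root} {f : H.root → ℤ}
    (hf : (IsKilling.rootSystem H).root β =
      ∑ γ ∈ b.support, f γ • (IsKilling.rootSystem H).root γ) : coeffSimple b α β = f α := by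
  have h : (IsKilling.rootSystem H).rootSpanMem ℤ β =
      ∑ γ : b.support, f γ • b.toWeightBasisInt γ := by
    ext1
    simp only [Submodule.coe_sum, Submodule.coe_smul, RootPairing.Base.coe_toWeightBasisInt_apply]
    rw [hf, ← Finset.sum_coe_sort]
  rw [coeffSimple, h, Module.Basis.repr_sum_self]

theorem coeffSimple_nonneg_of_isPos {β : H.root} (hβ : b.IsPos β) : 0 ≤ coeffSimple b α β := by
  obtain ⟨f, -, hf, hs⟩ := b.exists_root_eq_sum_int β
  rw [coeffSimple_eq_of_root_eq_sum b α hs]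
  rcases hf with hf | hf
  · exact hf.le _
  · rw [b.isPos_iff, RootPairing.Base.height_eq_sum hs] at hβ
    exact absurd hβ (not_lt.2 (Finset.sum_nonpos fun γ _ => hf.le γ))

theorem coeffSimple_nonpos_of_not_isPos {β : H.root} (hβ : ¬ b.IsPos β) :
    coeffSimple b α β ≤ 0 := by
  obtain ⟨f, -, hf, hs⟩ := b.exists_root_eq_sum_int β
  rw [coeffSimple_eq_of_root_eq_sum b α hs]
  rcases hf with hf | hf
  · rw [b.isPos_iff', RootPairing.Base.height_eq_sum hs] at hβ
    exact absurd (Finset.sum_nonneg fun γ _ => hf.le γ) hβ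
  · exact hf.le _

theorem neg_le_coeffSimple_of_isHighestRoot {θ : H.root} (hθ : IsHighestRoot b θ) (β : H.root) :
    -coeffSimple b α θ ≤ coeffSimple b α β := by
  have := hθ ((IsKilling.rootSystem H).reflectionPerm β β) α
  rw [coeffSimple_reflectionPerm_self] at this
  lia

/-- Positive roots have nonnegative coefficients and the others nonpositive ones, so the roots of
the parabolic are exactly those with `α`-coefficient at most `0`. -/
theorem parabolic_eq : parabolic b α = levi b α ⊔ nilradical b α := by
  apply le_antisymm
  · refine sup_le (le_sup_of_le_left le_sup_left) (rootSum_le fun β hβ => ?_)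
    rcases (show coeffSimple b α β ≤ 0 from hβ.elim (coeffSimple_nonpos_of_not_isPos b α)
      fun h => h.2.le).lt_or_eq with h | h
    · exact le_sup_of_le_right (rootSpace_le_rootSum h)
    · exact le_sup_of_le_left (le_sup_of_le_right (rootSpace_le_rootSum h))
  · refine sup_le (sup_le le_sup_left (rootSum_le fun β hβ => ?_)) (rootSum_le fun β hβ => ?_)
    · refine le_sup_of_le_right (rootSpace_le_rootSum ?_)
      by_cases h : b.IsPos β
      · exact Or.inr ⟨h, hβ⟩
      · exact Or.inl h
    · exact le_sup_of_le_right (rootSpace_le_rootSum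
        (Or.inl fun h => absurd (coeffSimple_nonneg_of_isPos b α h) (not_le.2 hβ)))

theorem mem_equalReductivePart_iff (p : 𝔤 × 𝔤) : p ∈ equalReductivePart b α ↔
    ∃ z ∈ levi b α, p.1 - z ∈ nilradical b α ∧ p.2 - z ∈ nilradical b α := by
  refine ⟨fun h => h.2.2, fun h => ⟨?_, ?_, h⟩⟩ <;> obtain ⟨z, hz, h1, h2⟩ := h <;>
    rw [parabolic_eq]
  · rw [← add_sub_cancel z p.1]
    exact add_mem (le_sup_left (a := levi b α) hz) (le_sup_right (a := levi b α) h1)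
  · rw [← add_sub_cancel z p.2]
    exact add_mem (le_sup_left (a := levi b α) hz) (le_sup_right (a := levi b α) h2)

theorem weightFiltration_vertex_one_zero :
    weightFiltration (vertex b α 1) 0 = parabolic b α := by
  rw [parabolic_eq]
  apply le_antisymm
  · refine weightFiltration_le _ (fun _ => le_sup_of_le_left le_sup_left) fun β hβ => ?_
    rw [re_root_vertex, Int.cast_one, div_one, Int.cast_nonpos] at hβ
    rcases hβ.lt_or_eq with h | h
    · exact le_sup_of_le_right (rootSpace_le_rootSum h)
    · exact le_sup_of_le_left (le_sup_of_le_right (rootSpace_le_rootSum h))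
  · refine sup_le (sup_le (cartan_le_weightFiltration _ le_rfl) (rootSum_le fun β hβ => ?_))
      (rootSum_le fun β hβ => ?_) <;> refine rootSpace_le_weightFiltration _ _ ?_ <;>
      rw [re_root_vertex, Int.cast_one, div_one, Int.cast_nonpos]
    · exact hβ.le
    · exact hβ.le

theorem weightFiltration_vertex_one_neg_one :
    weightFiltration (vertex b α 1) (-1) = nilradical b α := by
  apply le_antisymm
  · refine weightFiltration_le _ (fun h => absurd h (by norm_num)) fun β hβ =>
      rootSpace_le_rootSum ?_
    rw [re_root_vertex, Int.cast_one, div_one] at hβ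
    have : coeffSimple b α β ≤ -1 := by exact_mod_cast hβ
    exact lt_of_le_of_lt this (by norm_num)
  · refine rootSum_le fun β hβ => rootSpace_le_weightFiltration _ _ ?_
    rw [re_root_vertex, Int.cast_one, div_one]
    exact_mod_cast Int.le_sub_one_of_lt hβ

variable {b α}

theorem weightFiltration_vertex_one_eq_top {θ : H.root} (hθ : IsHighestRoot b θ)
    (hk : coeffSimple b α θ = 1) {r : ℝ} (hr : 1 ≤ r) :
    weightFiltration (vertex b α 1) r = ⊤ := by
  rw [eq_top_iff, ← weightSum_univ (H := H)]
  refine iSup₂_le fun χ _ => ?_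
  refine (rootSpace_le_weightFiltration_re (vertex b α 1) χ).trans (weightFiltration_le _ (fun _ => cartan_le_weightFiltration _ (by linarith))
    fun β _ => rootSpace_le_weightFiltration _ _ (le_trans ?_ hr))
  have h := hθ β α
  rw [hk] at h
  rw [re_root_vertex, Int.cast_one, div_one]
  exact_mod_cast h

theorem weightFiltration_vertex_one_eq_bot {θ : H.root} (hθ : IsHighestRoot b θ)
    (hk : coeffSimple b α θ = 1) {r : ℝ} (hr : r < -1) :
    weightFiltration (vertex b α 1) r = ⊥ := by
  refine eq_bot_iff.2 (weightFiltration_le _ (fun h => absurd h (by linarith)) fun β hβ => ?_)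
  rw [re_root_vertex, Int.cast_one, div_one] at hβ
  have h1 := neg_le_coeffSimple_of_isHighestRoot b α hθ β
  rw [hk] at h1
  have h2 : (-1 : ℝ) ≤ coeffSimple b α β := by exact_mod_cast h1
  linarith

/-- The Killing complement of `F_n` only involves weights with value `< -n`. At `k = 1` these values
are integers, so the bound sharpens to `≤ -n - 1`. This is the point where `k = 1` is decisive. -/
theorem mem_weightFiltration_vertex_one_of_orthogonal {n : ℤ} {x : 𝔤}
    (hx : ∀ y ∈ weightFiltration (vertex b α 1) n, killingForm ℂ 𝔤 y x = 0) :
    x ∈ weightFiltration (vertex b α 1) ((-n - 1 : ℤ) : ℝ) := by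
  have h1 : x ∈ weightSum {χ : H → ℂ | (χ (vertex b α 1)).re < -n} := by
    refine mem_weightSum_of_forall_killingForm_eq_zero (fun χ => ?_) hx
    rcases lt_or_ge (χ (vertex b α 1)).re (-n) with h | h
    · exact Or.inl h
    · right
      rw [Set.mem_ofPred_eq, Pi.neg_apply, Complex.neg_re]
      linarith
  refine weightSum_induction h1 (fun χ hχ y hy => ?_) (zero_mem _) fun _ _ => add_mem
  have key := rootSpace_le_weightFiltration_re (vertex b α 1) χ hy
  rw [Set.mem_ofPred_eq] at hχ
  refine weightFiltration_le _ (fun h => cartan_le_weightFiltration _ ?_)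
    (fun β hβ => rootSpace_le_weightFiltration _ _ ?_) key
  · have : (0 : ℤ) < -n := by exact_mod_cast lt_of_le_of_lt h hχ
    exact_mod_cast Int.le_sub_one_of_lt this
  · have h2 := lt_of_le_of_lt hβ hχ
    rw [re_root_vertex, Int.cast_one, div_one] at h2 ⊢
    have : coeffSimple b α β < -n := by exact_mod_cast h2
    exact_mod_cast Int.le_sub_one_of_lt this

end Weights

/-! ### Coefficients of formal series and of loops -/

section Coefficients

variable {K 𝔤 : Type*} [Field K] [LieRing 𝔤] [LieAlgebra K 𝔤]

/-- The coefficient of `t ^ n` in an element of `𝔤((t))`. -/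
def formalCoeff (n : ℤ) : Formal K 𝔤 →ₗ[K] 𝔤 :=
  TensorProduct.lift <| LinearMap.mk₂ K (fun f x => HahnSeries.coeff f n • x)
    (fun f g x => by rw [HahnSeries.coeff_add, add_smul])
    (fun c f x => by rw [HahnSeries.coeff_smul, smul_assoc])
    (fun f x y => smul_add _ _ _)
    (fun c f x => smul_comm _ _ _)

@[simp]
theorem formalCoeff_tmul (n : ℤ) (f : Laurent K) (x : 𝔤) :
    formalCoeff n (f ⊗ₜ[K] x) = f.coeff n • x := rfl

theorem exists_forall_lt_formalCoeff_eq_zero (f : Formal K 𝔤) :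
    ∃ N : ℤ, ∀ n < N, formalCoeff n f = 0 := by
  induction f using TensorProduct.induction_on with
  | zero => exact ⟨0, by simp⟩
  | tmul a x =>
    exact ⟨a.order, fun n hn => by
      rw [formalCoeff_tmul, HahnSeries.coeff_eq_zero_of_lt_order hn, zero_smul]⟩
  | add f g hf hg =>
    obtain ⟨N, hN⟩ := hf
    obtain ⟨N', hN'⟩ := hg
    exact ⟨min N N', fun n hn => by
      rw [map_add, hN n (by lia), hN' n (by lia), add_zero]⟩

/-- A basis of the finite-dimensional `𝔤` turns `f` into finitely many Laurent series, whose
coefficients are the coordinates of those of `f`. -/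
theorem mem_taylor_iff [FiniteDimensional K 𝔤] (f : Formal K 𝔤) :
    f ∈ taylor K 𝔤 ↔ ∀ n < 0, formalCoeff n f = 0 := by
  constructor
  · intro hf n hn
    have h : taylor K 𝔤 ≤ LinearMap.ker (formalCoeff n) := by
      refine Submodule.map₂_le.2 fun a ha x _ => ?_
      change formalCoeff n (a ⊗ₜ[K] x) = 0
      rw [formalCoeff_tmul, ha n (by exact_mod_cast hn), zero_smul]
    exact h hf
  · intro hf
    let e := Module.finBasis K 𝔤
    obtain ⟨s, rfl⟩ := (TensorProduct.equivFinsuppOfBasisRight (M := Laurent K) e).symm.surjective f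
    rw [← LinearEquiv.coe_coe, TensorProduct.equivFinsuppOfBasisRight_symm] at hf ⊢
    simp only [Finsupp.lsum_apply, Finsupp.sum_fintype, LinearMap.flip_apply, map_zero,
      implies_true, TensorProduct.mk_apply] at hf ⊢
    refine sum_mem fun i _ => Submodule.apply_mem_map₂ _ (fun n hn => ?_) trivial
    have h := hf n (by exact_mod_cast hn)
    simp only [map_sum, formalCoeff_tmul] at h
    exact Fintype.linearIndependent_iff.1 e.linearIndependent _ h i

theorem eq_zero_of_forall_formalCoeff_eq_zero [FiniteDimensional K 𝔤] {f : Formal K 𝔤}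
    (hf : ∀ n, formalCoeff n f = 0) : f = 0 := by
  let e := Module.finBasis K 𝔤
  obtain ⟨s, rfl⟩ := (TensorProduct.equivFinsuppOfBasisRight (M := Laurent K) e).symm.surjective f
  rw [← LinearEquiv.coe_coe, TensorProduct.equivFinsuppOfBasisRight_symm] at hf ⊢
  simp only [Finsupp.lsum_apply, Finsupp.sum_fintype, LinearMap.flip_apply, map_zero,
    implies_true, TensorProduct.mk_apply] at hf ⊢
  refine Finset.sum_eq_zero fun i _ => ?_
  have h0 : s i = 0 := by
    ext n
    have h := hf n
    simp only [map_sum, formalCoeff_tmul] at h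
    exact Fintype.linearIndependent_iff.1 e.linearIndependent _ h i
  rw [h0, TensorProduct.zero_tmul]

theorem formal_ext [FiniteDimensional K 𝔤] {f g : Formal K 𝔤}
    (h : ∀ n, formalCoeff n f = formalCoeff n g) : f = g :=
  sub_eq_zero.1 (eq_zero_of_forall_formalCoeff_eq_zero fun n => by rw [map_sub, h, sub_self])

theorem val_laurentVar_zpow (n : ℤ) :
    ((laurentVar K ^ n : (Laurent K)ˣ) : Laurent K) = HahnSeries.single n 1 := by
  rw [Units.val_zpow_eq_zpow_val, laurentVar, Units.val_mk0, ← RatFunc.single_zpow]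

theorem toFormalZero_T_tmul (n : ℤ) (x : 𝔤) :
    toFormalZero K 𝔤 (LaurentPolynomial.T n ⊗ₜ[K] x) = HahnSeries.single n (1 : K) ⊗ₜ[K] x := by
  rw [toFormalZero, LieAlgebra.ExtendScalars.map_apply_tmul, laurentSubst_T, val_laurentVar_zpow]
  rfl

theorem toFormalInfty_T_tmul (n : ℤ) (x : 𝔤) :
    toFormalInfty K 𝔤 (LaurentPolynomial.T n ⊗ₜ[K] x) =
      HahnSeries.single (-n) (1 : K) ⊗ₜ[K] x := by
  rw [toFormalInfty, LieAlgebra.ExtendScalars.map_apply_tmul, laurentSubst_T, inv_zpow',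
    val_laurentVar_zpow]
  rfl

/-- The loop `∑ u ^ n ⊗ φ n`. -/
def loopOfCoeff : (ℤ →₀ 𝔤) →ₗ[K] Loop K 𝔤 :=
  Finsupp.lsum K fun n => TensorProduct.mk K K[T;T⁻¹] 𝔤 (LaurentPolynomial.T n)

theorem loopOfCoeff_apply (φ : ℤ →₀ 𝔤) :
    loopOfCoeff (K := K) φ = ∑ n ∈ φ.support, LaurentPolynomial.T n ⊗ₜ[K] φ n := rfl

@[simp]
theorem loopOfCoeff_single (n : ℤ) (x : 𝔤) :
    loopOfCoeff (K := K) (Finsupp.single n x) = LaurentPolynomial.T n ⊗ₜ[K] x := by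
  simp [loopOfCoeff]

theorem loopOfCoeff_surjective : Function.Surjective (loopOfCoeff : (ℤ →₀ 𝔤) →ₗ[K] Loop K 𝔤) := by
  rw [← LinearMap.range_eq_top, eq_top_iff, ← TensorProduct.span_tmul_eq_top, Submodule.span_le]
  rintro _ ⟨p, x, rfl⟩
  induction p using LaurentPolynomial.induction_on' with
  | add p q hp hq => rw [TensorProduct.add_tmul]; exact add_mem hp hq
  | C_mul_T n a =>
    refine ⟨Finsupp.single n (a • x), ?_⟩
    rw [loopOfCoeff_single, TensorProduct.tmul_smul, TensorProduct.smul_tmul',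
      LaurentPolynomial.smul_eq_C_mul]

theorem formalCoeff_toFormalZero_T_tmul (m n : ℤ) (x : 𝔤) :
    formalCoeff m (toFormalZero K 𝔤 (LaurentPolynomial.T n ⊗ₜ[K] x)) =
      Finsupp.single n x m := by
  classical
  rw [toFormalZero_T_tmul, formalCoeff_tmul, HahnSeries.coeff_single, Finsupp.single_apply]
  by_cases h : m = n
  · simp [h]
  · simp [h, Ne.symm h]

theorem formalCoeff_toFormalZero_loopOfCoeff (m : ℤ) (φ : ℤ →₀ 𝔤) :
    formalCoeff m (toFormalZero K 𝔤 (loopOfCoeff φ)) = φ m := by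
  induction φ using Finsupp.induction_linear with
  | zero => simp
  | add φ ψ hφ hψ => simp [hφ, hψ]
  | single n x => rw [loopOfCoeff_single, formalCoeff_toFormalZero_T_tmul]

theorem formalCoeff_toFormalInfty_loopOfCoeff (m : ℤ) (φ : ℤ →₀ 𝔤) :
    formalCoeff m (toFormalInfty K 𝔤 (loopOfCoeff φ)) = φ (-m) := by
  classical
  induction φ using Finsupp.induction_linear with
  | zero => simp
  | add φ ψ hφ hψ => simp [hφ, hψ]
  | single n x =>
    rw [loopOfCoeff_single, toFormalInfty_T_tmul, formalCoeff_tmul, HahnSeries.coeff_single,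
      Finsupp.single_apply]
    by_cases h : n = -m
    · simp [h]
    · rw [if_neg (by lia), if_neg h, zero_smul]

theorem toFormalZero_injective : Function.Injective (toFormalZero K 𝔤) := by
  refine (injective_iff_map_eq_zero _).2 fun l hl => ?_
  obtain ⟨φ, rfl⟩ := loopOfCoeff_surjective l
  have : φ = 0 := by
    ext n
    rw [← formalCoeff_toFormalZero_loopOfCoeff (K := K), hl, map_zero, Finsupp.zero_apply]
  rw [this, map_zero]

/-- An element of `𝔤((t))` with finitely many nonzero coefficients comes from a loop. -/
theorem exists_toFormalZero_coeff (f : Formal K 𝔤) (M : ℤ) :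
    ∃ φ : ℤ →₀ 𝔤, (∀ n < M, φ n = formalCoeff n f) ∧ ∀ n, M ≤ n → φ n = 0 := by
  obtain ⟨N, hN⟩ := exists_forall_lt_formalCoeff_eq_zero f
  refine ⟨Finsupp.onFinset (Finset.Ico N M) (fun n => if n < M then formalCoeff n f else 0) ?_,
    fun n hn => ?_, fun n hn => ?_⟩
  · intro n hn
    rw [Finset.mem_Ico]
    by_contra! h
    rcases lt_or_ge n N with h1 | h1
    · simp [hN n h1] at hn
    · simp [h h1] at hn
  · simp [hn]
  · simp [not_lt.2 hn]

end Coefficients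

/-! ### The Killing form over Laurent series and the expansion of `a(u)` -/

section Killing

variable {K 𝔤 : Type*} [Field K] [LieRing 𝔤] [LieAlgebra K 𝔤] [FiniteDimensional K 𝔤]

theorem killingForm_formal_tmul (a c : Laurent K) (x y : 𝔤) :
    killingForm (Laurent K) (Formal K 𝔤) (a ⊗ₜ[K] x) (c ⊗ₜ[K] y) =
      killingForm K 𝔤 x y • (a * c) := by
  rw [killingForm, LieModule.traceForm_baseChange, LinearMap.BilinForm.baseChange_tmul]

theorem coeff_killingForm_tmul (f : Formal K 𝔤) (m n : ℤ) (x : 𝔤) :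
    (killingForm (Laurent K) (Formal K 𝔤) (HahnSeries.single m (1 : K) ⊗ₜ[K] x) f).coeff n =
      killingForm K 𝔤 x (formalCoeff (n - m) f) := by
  induction f using TensorProduct.induction_on with
  | zero => simp
  | add f g hf hg => rw [map_add, HahnSeries.coeff_add, hf, hg, map_add, map_add]
  | tmul a y =>
    rw [killingForm_formal_tmul, HahnSeries.coeff_smul, formalCoeff_tmul,
      HahnSeries.coeff_single_mul, map_smul, one_mul, smul_eq_mul, smul_eq_mul, mul_comm]

theorem smul_single_eq (c a : K) (n : ℤ) :
    c • (HahnSeries.single n a : Laurent K) = HahnSeries.single n (c * a) := by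
  ext m
  rw [HahnSeries.coeff_smul, HahnSeries.coeff_single, HahnSeries.coeff_single, smul_eq_mul,
    mul_ite, mul_zero]

theorem one_sub_mul_geometric (c : K) :
    (1 - HahnSeries.single (1 : ℤ) c) *
      HahnSeries.ofPowerSeries ℤ K (PowerSeries.mk (c ^ ·)) = 1 := by
  have h1 : HahnSeries.single (1 : ℤ) c =
      HahnSeries.ofPowerSeries ℤ K (PowerSeries.C c * PowerSeries.X) := by
    rw [map_mul, HahnSeries.ofPowerSeries_X, HahnSeries.ofPowerSeries_C, HahnSeries.C_mul_eq_smul]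
    ext n
    simp [HahnSeries.coeff_single]
  rw [h1, ← map_one (HahnSeries.ofPowerSeries ℤ K), ← map_sub, ← map_mul]
  congr 1
  ext n
  rw [sub_mul, one_mul, map_sub, mul_assoc, PowerSeries.coeff_C_mul, PowerSeries.coeff_mk]
  cases n with
  | zero => simp
  | succ n => simp [PowerSeries.coeff_succ_X_mul, pow_succ', PowerSeries.coeff_one]

/-- Partial fractions, each pole contributing a geometric series. -/
theorem aSeries_eq {c₁ c₂ : K} (hc : c₁ ≠ c₂) :
    aSeries c₁ c₂ = (c₁ - c₂)⁻¹ • (c₁ • HahnSeries.ofPowerSeries ℤ K (PowerSeries.mk (c₁ ^ ·)) -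
      c₂ • HahnSeries.ofPowerSeries ℤ K (PowerSeries.mk (c₂ ^ ·))) := by
  have h1 := one_sub_mul_geometric c₁
  have h2 := one_sub_mul_geometric c₂
  have h3 : c₂ • (1 - HahnSeries.single (1 : ℤ) c₁) - c₁ • (1 - HahnSeries.single (1 : ℤ) c₂) =
      (c₂ - c₁) • (1 : Laurent K) := by
    rw [smul_sub, smul_sub, smul_single_eq, smul_single_eq, mul_comm c₂ c₁, sub_sub_sub_cancel_right, sub_smul]
  rw [aSeries]
  refine inv_eq_of_mul_eq_one_right ?_
  generalize HahnSeries.ofPowerSeries ℤ K (PowerSeries.mk (c₁ ^ ·)) = A at *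
  generalize HahnSeries.ofPowerSeries ℤ K (PowerSeries.mk (c₂ ^ ·)) = B at *
  generalize 1 - HahnSeries.single (1 : ℤ) c₁ = p at *
  generalize 1 - HahnSeries.single (1 : ℤ) c₂ = q at *
  have h4 : p * q * (c₁ • A - c₂ • B) = (c₁ - c₂) • (1 : Laurent K) := by
    calc p * q * (c₁ • A - c₂ • B) = c₁ • ((p * A) * q) - c₂ • ((q * B) * p) := by
          simp only [Algebra.smul_def]; ring
      _ = -(c₂ • p - c₁ • q) := by rw [h1, h2]; simp
      _ = (c₁ - c₂) • (1 : Laurent K) := by rw [h3, ← neg_smul, neg_sub]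
  rw [mul_smul_comm, h4, smul_smul, inv_mul_cancel₀ (sub_ne_zero.2 hc), one_smul]

/-- The bound reaches `-1`, one below the order of `a(u)`: there both sides vanish. The residue
computation needs this boundary case. -/
theorem coeff_aSeries {c₁ c₂ : K} (hc : c₁ ≠ c₂) {n : ℤ} (hn : -1 ≤ n) :
    (aSeries c₁ c₂).coeff n = (c₁ - c₂)⁻¹ * (c₁ ^ (n + 1) - c₂ ^ (n + 1)) := by
  rw [aSeries_eq hc, HahnSeries.coeff_smul, HahnSeries.coeff_sub, HahnSeries.coeff_smul,
    HahnSeries.coeff_smul, smul_eq_mul, smul_eq_mul, smul_eq_mul]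
  obtain ⟨m, hm⟩ := Int.eq_ofNat_of_zero_le (show 0 ≤ n + 1 by lia)
  congr 1
  rcases m with _ | m
  · obtain rfl : n = -1 := by lia
    have h (p : PowerSeries K) : (HahnSeries.ofPowerSeries ℤ K p).coeff (-1) = 0 := by
      rw [PowerSeries.coeff_coe]
      simp
    simp [h]
  · obtain rfl : n = m := by lia
    rw [HahnSeries.ofPowerSeries_apply_coeff, HahnSeries.ofPowerSeries_apply_coeff,
      PowerSeries.coeff_mk, PowerSeries.coeff_mk]
    norm_cast
    rw [pow_succ', pow_succ']

/-- For `p = (u⁻¹ - c₁) (u⁻¹ - c₂)`, we have `a(u) p = u ^ (-2)`. -/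
theorem aSeries_mul (c₁ c₂ : K) :
    aSeries c₁ c₂ * (HahnSeries.single (-2 : ℤ) 1 - (c₁ + c₂) • HahnSeries.single (-1 : ℤ) 1 +
      (c₁ * c₂) • HahnSeries.single (0 : ℤ) 1) = HahnSeries.single (-2 : ℤ) (1 : K) := by
  have h (c : K) : (1 - HahnSeries.single (1 : ℤ) c : Laurent K) ≠ 0 :=
    left_ne_zero_of_mul_eq_one (one_sub_mul_geometric c)
  rw [aSeries, inv_mul_eq_iff_eq_mul₀ (mul_ne_zero (h c₁) (h c₂))]
  have h2 : HahnSeries.single (-1 : ℤ) (c₁ + c₂) = HahnSeries.single (-1 : ℤ) c₁ +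
      HahnSeries.single (-1 : ℤ) c₂ := by
    have h3 (c : K) : (HahnSeries.single (-1 : ℤ) c : Laurent K) =
        c • HahnSeries.single (-1 : ℤ) 1 := by rw [smul_single_eq, mul_one]
    rw [h3, h3 c₁, h3 c₂, add_smul]
  simp only [smul_single_eq, mul_one, sub_mul, mul_sub, one_mul, HahnSeries.single_mul_single, h2]
  norm_num
  abel

end Killing

/-! ### The residue form on loops -/

section ResidueForm

variable {K 𝔤 : Type*} [Field K] [LieRing 𝔤] [LieAlgebra K 𝔤]

theorem residueForm_apply (a : Laurent K) (f g : Formal K 𝔤) :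
    residueForm 𝔤 a f g = (a * killingForm (Laurent K) (Formal K 𝔤) f g).coeff (-1) := rfl

theorem residueForm_comm (a : Laurent K) (f g : Formal K 𝔤) :
    residueForm 𝔤 a f g = residueForm 𝔤 a g f := by
  rw [residueForm_apply, residueForm_apply, LieModule.traceForm_comm]

theorem pairForm_apply (p q : 𝔤 × 𝔤) :
    pairForm K 𝔤 p q = killingForm K 𝔤 p.1 q.1 - killingForm K 𝔤 p.2 q.2 := rfl

theorem evalPair_apply (c₁ c₂ : Kˣ) (l : Loop K 𝔤) :
    evalPair K 𝔤 c₁ c₂ l = (evalAt K 𝔤 c₁ l, evalAt K 𝔤 c₂ l) := rfl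

theorem evalPair_T_zero_add_T_one (c₁ c₂ : Kˣ) (x y : 𝔤) :
    evalPair K 𝔤 c₁ c₂ (LaurentPolynomial.T 0 ⊗ₜ[K] x + LaurentPolynomial.T 1 ⊗ₜ[K] y) =
      (x + (c₁ : K)⁻¹ • y, x + (c₂ : K)⁻¹ • y) := by
  simp only [evalPair_apply, map_add, evalAt_T, neg_zero, zpow_zero, one_smul, zpow_neg_one,
    Prod.mk_add_mk]

/-- The product of the loop `u ^ n ⊗ x` and `(u⁻¹ - c₁) (u⁻¹ - c₂)`. -/
def shiftedLoop (c₁ c₂ : K) (n : ℤ) (x : 𝔤) : Loop K 𝔤 :=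
  LaurentPolynomial.T (n - 2) ⊗ₜ[K] x - (c₁ + c₂) • (LaurentPolynomial.T (n - 1) ⊗ₜ[K] x) +
    (c₁ * c₂) • (LaurentPolynomial.T n ⊗ₜ[K] x)

theorem evalAt_shiftedLoop_left (c₁ c₂ : Kˣ) (n : ℤ) (x : 𝔤) :
    evalAt K 𝔤 c₁ (shiftedLoop (c₁ : K) c₂ n x) = 0 := by
  rw [shiftedLoop, map_add, map_sub, map_smul, map_smul, evalAt_T, evalAt_T, evalAt_T, smul_smul,
    smul_smul, ← sub_smul, ← add_smul]
  have h1 : (c₁ : K) ^ (-(n - 2)) = (c₁ : K) ^ (-n) * c₁ ^ 2 := by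
    rw [neg_sub, sub_eq_neg_add, zpow_add₀ c₁.ne_zero]; norm_cast
  have h2 : (c₁ : K) ^ (-(n - 1)) = (c₁ : K) ^ (-n) * c₁ := by
    rw [neg_sub, sub_eq_neg_add, zpow_add_one₀ c₁.ne_zero]
  rw [h1, h2]
  convert zero_smul K x using 2
  ring

theorem shiftedLoop_comm (c₁ c₂ : K) (n : ℤ) (x : 𝔤) :
    shiftedLoop c₁ c₂ n x = shiftedLoop c₂ c₁ n x := by
  rw [shiftedLoop, shiftedLoop, add_comm c₁, mul_comm c₁]

theorem evalPair_shiftedLoop (c₁ c₂ : Kˣ) (n : ℤ) (x : 𝔤) :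
    evalPair K 𝔤 c₁ c₂ (shiftedLoop (c₁ : K) c₂ n x) = 0 := by
  rw [evalPair_apply, evalAt_shiftedLoop_left, shiftedLoop_comm, evalAt_shiftedLoop_left]
  rfl

variable [FiniteDimensional K 𝔤]

/-- The factor `(u⁻¹ - c₁)(u⁻¹ - c₂)` cancels the denominator of `a(u)` and leaves `u ^ (n - 2) κ(x,
f)`, whose residue involves only the coefficient of index `1 - n`. -/
theorem residueForm_shiftedLoop (c₁ c₂ : K) (n : ℤ) (x : 𝔤) (f : Formal K 𝔤) :
    residueForm 𝔤 (aSeries c₁ c₂) (toFormalZero K 𝔤 (shiftedLoop c₁ c₂ n x)) f =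
      killingForm K 𝔤 x (formalCoeff (1 - n) f) := by
  have h : toFormalZero K 𝔤 (shiftedLoop c₁ c₂ n x) =
      (HahnSeries.single (-2 : ℤ) 1 - (c₁ + c₂) • HahnSeries.single (-1 : ℤ) 1 +
        (c₁ * c₂) • HahnSeries.single (0 : ℤ) 1 : Laurent K) •
        (HahnSeries.single n (1 : K) ⊗ₜ[K] x : Formal K 𝔤) := by
    rw [TensorProduct.smul_tmul', shiftedLoop, map_add, map_sub, map_smul, map_smul,
      toFormalZero_T_tmul, toFormalZero_T_tmul, toFormalZero_T_tmul, TensorProduct.smul_tmul',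
      TensorProduct.smul_tmul', ← TensorProduct.sub_tmul, ← TensorProduct.add_tmul]
    congr 1
    rw [smul_eq_mul, add_mul, sub_mul, smul_mul_assoc, smul_mul_assoc,
      HahnSeries.single_mul_single, HahnSeries.single_mul_single, HahnSeries.single_mul_single]
    simp only [mul_one, zero_add]
    rw [sub_eq_neg_add n 2, sub_eq_neg_add n 1]
  rw [residueForm_apply, h, map_smul, LinearMap.smul_apply, smul_eq_mul, ← mul_assoc, aSeries_mul,
    HahnSeries.coeff_single_mul, one_mul, coeff_killingForm_tmul]
  norm_num

theorem residueForm_T_tmul (a : Laurent K) (m n : ℤ) (x y : 𝔤) :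
    residueForm 𝔤 a (toFormalZero K 𝔤 (LaurentPolynomial.T m ⊗ₜ[K] x))
      (toFormalZero K 𝔤 (LaurentPolynomial.T n ⊗ₜ[K] y)) =
      a.coeff (-1 - (m + n)) * killingForm K 𝔤 x y := by
  rw [residueForm_apply, toFormalZero_T_tmul, toFormalZero_T_tmul, killingForm_formal_tmul,
    HahnSeries.single_mul_single, mul_smul_comm, HahnSeries.coeff_smul, HahnSeries.coeff_mul_single,
    mul_one, mul_one, smul_eq_mul, mul_comm]

/-- The residue theorem: if `κ(f, g)` is a polynomial in `u⁻¹`, then `Q_a(f, g)` is determined by the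
values of `f` and `g` at the two poles of `a(u)`. -/
theorem residueForm_toFormalZero {c₁ c₂ : Kˣ} (hc : (c₁ : K) ≠ c₂) (φ ψ : ℤ →₀ 𝔤)
    (h : ∀ m n, 0 < m + n → killingForm K 𝔤 (φ m) (ψ n) = 0) :
    residueForm 𝔤 (aSeries (c₁ : K) c₂) (toFormalZero K 𝔤 (loopOfCoeff φ))
      (toFormalZero K 𝔤 (loopOfCoeff ψ)) =
      ((c₁ : K) - c₂)⁻¹ * pairForm K 𝔤 (evalPair K 𝔤 c₁ c₂ (loopOfCoeff φ))
        (evalPair K 𝔤 c₁ c₂ (loopOfCoeff ψ)) := by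
  rw [pairForm_apply, evalPair_apply, evalPair_apply, loopOfCoeff_apply, loopOfCoeff_apply]
  simp only [map_sum, LinearMap.sum_apply, evalAt_T, map_smul, LinearMap.smul_apply, smul_eq_mul,
    residueForm_T_tmul]
  rw [← Finset.sum_sub_distrib, Finset.mul_sum]
  refine Finset.sum_congr rfl fun n _ => ?_
  rw [Finset.mul_sum, Finset.mul_sum, ← Finset.sum_sub_distrib, Finset.mul_sum]
  refine Finset.sum_congr rfl fun m _ => ?_
  -- For `m + n ≤ 0` the index `-1 - (m + n)` is at least `-1`, the range of the closed formula for
  -- `a(u)`; otherwise the Killing factor vanishes.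
  rcases le_or_gt (m + n) 0 with h1 | h1
  · rw [coeff_aSeries hc (by lia)]
    have h2 (c : Kˣ) : (c : K) ^ (-1 - (m + n) + 1) = (c : K) ^ (-m) * (c : K) ^ (-n) := by
      rw [← zpow_add₀ c.ne_zero]
      congr 1
      ring
    rw [h2, h2]
    ring
  · rw [h m n h1]
    ring

end ResidueForm

/-! ### The order in terms of the filtration -/

section OrderLoops

set_option linter.unusedSectionVars false

open LieAlgebra

variable {𝔤 : Type*} [LieRing 𝔤] [LieAlgebra ℂ 𝔤] [FiniteDimensional ℂ 𝔤]
  [LieAlgebra.IsKilling ℂ 𝔤] {H : LieSubalgebra ℂ 𝔤} [H.IsCartanSubalgebra]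

/-- `𝕆_h ∩ 𝔤[u, u⁻¹]`, as a subalgebra of `𝔤[u, u⁻¹]`. -/
def orderLoopAlgebra (h : H) : LieSubalgebra ℂ (Loop ℂ 𝔤) where
  -- The monomial `u ^ n` has valuation `-n` in the variable `u⁻¹`, whence the sign.
  carrier := {l | ∀ n : ℤ, formalCoeff n (toFormalZero ℂ 𝔤 l) ∈ weightFiltration h (-n)}
  zero_mem' := fun n => by simp
  add_mem' := fun hl hl' n => by rw [map_add, map_add]; exact add_mem (hl n) (hl' n)
  smul_mem' := fun c l hl n => by rw [map_smul, map_smul]; exact Submodule.smul_mem _ c (hl n)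
  lie_mem' := by
    intro l l' hl hl' n
    obtain ⟨φ, rfl⟩ := loopOfCoeff_surjective l
    obtain ⟨ψ, rfl⟩ := loopOfCoeff_surjective l'
    simp only [Set.mem_ofPred_eq, formalCoeff_toFormalZero_loopOfCoeff] at hl hl'
    rw [loopOfCoeff_apply, loopOfCoeff_apply, sum_lie, map_sum, map_sum]
    refine sum_mem fun i _ => ?_
    rw [lie_sum, map_sum, map_sum]
    refine sum_mem fun j _ => ?_
    rw [ExtendScalars.bracket_tmul, ← LaurentPolynomial.T_add, formalCoeff_toFormalZero_T_tmul]
    by_cases hn : i + j = n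
    · subst hn
      rw [Finsupp.single_eq_same]
      convert lie_mem_weightFiltration h (hl i) (hl' j) using 2
      push_cast
      ring
    · rw [Finsupp.single_eq_of_ne (Ne.symm hn)]
      exact zero_mem _

theorem loopOfCoeff_mem_orderLoopAlgebra {h : H} {φ : ℤ →₀ 𝔤} :
    loopOfCoeff φ ∈ orderLoopAlgebra h ↔ ∀ n : ℤ, φ n ∈ weightFiltration h (-n) := by
  change (∀ n : ℤ, _) ↔ _
  simp only [formalCoeff_toFormalZero_loopOfCoeff]

theorem formalCoeff_mem_of_mem_tensorSpan {h : H} {r : ℝ} {V : Submodule ℂ 𝔤}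
    (hV : ∀ n : ℤ, r ≤ n → V ≤ weightFiltration h n) {f : Formal ℂ 𝔤}
    (hf : f ∈ tensorSpan (valuationGE ℂ r) V) (n : ℤ) :
    formalCoeff n f ∈ weightFiltration h n := by
  have h1 : tensorSpan (valuationGE ℂ r) V ≤ (weightFiltration h n).comap (formalCoeff n) := by
    refine Submodule.map₂_le.2 fun a ha x hx => ?_
    change formalCoeff n (a ⊗ₜ[ℂ] x) ∈ weightFiltration h n
    rw [formalCoeff_tmul]
    rcases lt_or_ge (n : ℝ) r with hn | hn
    · rw [ha n hn, zero_smul]; exact zero_mem _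
    · exact Submodule.smul_mem _ _ (hV n hn hx)
  exact h1 hf

theorem formalCoeff_mem_of_mem_maximalOrder {h : H} {f : Formal ℂ 𝔤} (hf : f ∈ maximalOrder h)
    (n : ℤ) : formalCoeff n f ∈ weightFiltration h n := by
  have h1 : maximalOrder h ≤ (weightFiltration h n).comap (formalCoeff n) := by
    refine sup_le (fun f hf => ?_) (iSup_le fun β f hf => ?_)
    · exact formalCoeff_mem_of_mem_tensorSpan (fun m hm => cartan_le_weightFiltration h hm) hf n
    · exact formalCoeff_mem_of_mem_tensorSpan
        (fun m hm => rootSpace_le_weightFiltration h β hm) hf n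
  exact h1 hf

theorem single_tmul_mem_maximalOrder {h : H} {n : ℤ} {x : 𝔤} (hx : x ∈ weightFiltration h n) :
    HahnSeries.single n (1 : ℂ) ⊗ₜ[ℂ] x ∈ maximalOrder h := by
  have hval {r : ℝ} (hr : r ≤ n) : HahnSeries.single n (1 : ℂ) ∈ valuationGE ℂ r := fun m hm => by
    refine HahnSeries.coeff_single_of_ne ?_
    rintro rfl
    exact absurd hr (not_le.2 hm)
  have h1 : weightFiltration h n ≤
      (maximalOrder h).comap (TensorProduct.mk ℂ (Laurent ℂ) 𝔤 (HahnSeries.single n (1 : ℂ))) := by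
    refine weightFiltration_le h (fun hr y hy => ?_) fun β hβ y hy => ?_
    · exact le_sup_left (a := tensorSpan (valuationGE ℂ 0) H.toSubmodule)
        (Submodule.apply_mem_map₂ _ (hval hr) hy)
    · refine le_sup_right (a := tensorSpan (valuationGE ℂ 0) H.toSubmodule) ?_
      exact Submodule.mem_iSup_of_mem β (Submodule.apply_mem_map₂ _ (hval hβ) hy)
  exact h1 hx

/-- A loop is a finite sum of monomials, so membership in the order can be tested on each
coefficient separately. -/
theorem orderLoops_eq (h : H) : orderLoops h =
    (orderLoopAlgebra h).toSubmodule.map (toFormalZero ℂ 𝔤).toLinearMap := by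
  rw [orderLoops]
  congr 1
  ext l
  obtain ⟨φ, rfl⟩ := loopOfCoeff_surjective l
  change toFormalInfty ℂ 𝔤 (loopOfCoeff φ) ∈ maximalOrder h ↔ loopOfCoeff φ ∈ orderLoopAlgebra h
  rw [loopOfCoeff_mem_orderLoopAlgebra]
  constructor
  · intro hl n
    have := formalCoeff_mem_of_mem_maximalOrder hl (-n)
    rwa [formalCoeff_toFormalInfty_loopOfCoeff, neg_neg, Int.cast_neg] at this
  · intro hφ
    rw [loopOfCoeff_apply, map_sum]
    refine sum_mem fun n _ => ?_
    rw [toFormalInfty_T_tmul]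
    refine single_tmul_mem_maximalOrder ?_
    rw [Int.cast_neg]
    exact hφ n

theorem T_tmul_mem_orderLoopAlgebra {h : H} {n : ℤ} {x : 𝔤} (hx : x ∈ weightFiltration h (-n)) :
    LaurentPolynomial.T n ⊗ₜ[ℂ] x ∈ orderLoopAlgebra h := by
  rw [← loopOfCoeff_single, loopOfCoeff_mem_orderLoopAlgebra]
  intro m
  by_cases hm : m = n
  · rwa [hm, Finsupp.single_eq_same]
  · rw [Finsupp.single_eq_of_ne hm]; exact zero_mem _

/-- Multiplication by `u⁻¹` lowers exponents while the filtration grows, so it preserves the order.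
-/
theorem shiftedLoop_mem_orderLoopAlgebra {h : H} {n : ℤ} {x : 𝔤} (c₁ c₂ : ℂ)
    (hx : x ∈ weightFiltration h (-n)) : shiftedLoop c₁ c₂ n x ∈ orderLoopAlgebra h := by
  refine add_mem (sub_mem ?_ ((orderLoopAlgebra h).smul_mem _ ?_))
    ((orderLoopAlgebra h).smul_mem _ ?_) <;> refine T_tmul_mem_orderLoopAlgebra
      (weightFiltration_mono h ?_ hx) <;> push_cast <;> linarith

end OrderLoops

/-! ### Hypotheses of the reduction for `k = 1`, and the obstruction for `k > 1` -/

section Main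

variable {𝔤 : Type*} [LieRing 𝔤] [LieAlgebra ℂ 𝔤] [FiniteDimensional ℂ 𝔤]
  [LieAlgebra.IsKilling ℂ 𝔤] {H : LieSubalgebra ℂ 𝔤} [H.IsCartanSubalgebra]
  {b : (LieAlgebra.IsKilling.rootSystem H).Base} {α : b.support} {θ : H.root}

theorem residueForm_eq_pairForm {h : H} {c₁ c₂ : ℂˣ} (hc : (c₁ : ℂ) ≠ c₂) {l l' : Loop ℂ 𝔤}
    (hl : l ∈ orderLoopAlgebra h) (hl' : l' ∈ orderLoopAlgebra h) :
    residueForm 𝔤 (aSeries (c₁ : ℂ) c₂) (toFormalZero ℂ 𝔤 l) (toFormalZero ℂ 𝔤 l') =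
      ((c₁ : ℂ) - c₂)⁻¹ * pairForm ℂ 𝔤 (evalPair ℂ 𝔤 c₁ c₂ l) (evalPair ℂ 𝔤 c₁ c₂ l') := by
  obtain ⟨φ, rfl⟩ := loopOfCoeff_surjective l
  obtain ⟨ψ, rfl⟩ := loopOfCoeff_surjective l'
  rw [loopOfCoeff_mem_orderLoopAlgebra] at hl hl'
  refine residueForm_toFormalZero hc φ ψ fun m n hmn =>
    killingForm_eq_zero_of_mem_weightFiltration h ?_ (hl m) (hl' n)
  have : (0 : ℝ) < m + n := by exact_mod_cast hmn
  linarith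

theorem exists_evalPair_eq (hθ : IsHighestRoot b θ) (hk : coeffSimple b α θ = 1) {c₁ c₂ : ℂˣ}
    (hc : (c₁ : ℂ) ≠ c₂) (m : 𝔤 × 𝔤) :
    ∃ d ∈ orderLoopAlgebra (vertex b α 1), evalPair ℂ 𝔤 c₁ c₂ d = m := by
  have hc' : (c₁ : ℂ) - c₂ ≠ 0 := sub_ne_zero.2 hc
  have h1 := c₁.ne_zero
  have h2 := c₂.ne_zero
  -- Interpolation by `u⁻¹ x + u⁻² y`, whose coefficients are unrestricted since `F_1` is all of
  -- `𝔤`: the system is `cᵢ x + cᵢ² y = mᵢ`.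
  set y : 𝔤 := ((c₁ : ℂ) - c₂)⁻¹ • ((c₁ : ℂ)⁻¹ • m.1 - (c₂ : ℂ)⁻¹ • m.2) with hy
  set x : 𝔤 := (c₁ : ℂ)⁻¹ • m.1 - (c₁ : ℂ) • y with hx
  have htop (n : ℤ) (hn : n ≤ -1) (z : 𝔤) : z ∈ weightFiltration (vertex b α 1) (-n) := by
    rw [weightFiltration_vertex_one_eq_top hθ hk]
    · trivial
    · have : (n : ℝ) ≤ -1 := by exact_mod_cast hn
      linarith
  refine ⟨LaurentPolynomial.T (-1) ⊗ₜ[ℂ] x + LaurentPolynomial.T (-2) ⊗ₜ[ℂ] y,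
    add_mem (T_tmul_mem_orderLoopAlgebra (htop _ (by norm_num) _))
      (T_tmul_mem_orderLoopAlgebra (htop _ (by norm_num) _)), ?_⟩
  rw [evalPair_apply]
  refine Prod.ext ?_ ?_
  · simp only [map_add, evalAt_T, neg_neg, zpow_one]
    rw [hx]
    norm_cast
    match_scalars <;> field_simp <;> ring
  · simp only [map_add, evalAt_T, neg_neg, zpow_one]
    rw [hx, hy]
    norm_cast
    match_scalars <;> field_simp <;> ring

theorem exists_mem_orderLoopAlgebra_of_orthogonal (hθ : IsHighestRoot b θ)
    (hk : coeffSimple b α θ = 1) {c₁ c₂ : ℂˣ} {f : Formal ℂ 𝔤}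
    (hf : ∀ d ∈ orderLoopAlgebra (vertex b α 1), evalPair ℂ 𝔤 c₁ c₂ d = 0 →
      residueForm 𝔤 (aSeries (c₁ : ℂ) c₂) (toFormalZero ℂ 𝔤 d) f = 0) :
    ∃ d ∈ orderLoopAlgebra (vertex b α 1), toFormalZero ℂ 𝔤 d = f := by
  have hcoeff (n : ℤ) : formalCoeff n f ∈ weightFiltration (vertex b α 1) (-n) := by
    have h1 : ∀ y ∈ weightFiltration (vertex b α 1) ((n - 1 : ℤ) : ℝ),
        -- The test loop `(u⁻¹ - c₁)(u⁻¹ - c₂) u ^ (1 - n) y` lies in the order, vanishes at both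
        -- poles, and isolates the coefficient of index `n`.
        killingForm ℂ 𝔤 y (formalCoeff n f) = 0 := by
      intro y hy
      have h2 := hf (shiftedLoop (c₁ : ℂ) c₂ (1 - n) y)
        (shiftedLoop_mem_orderLoopAlgebra _ _ (by rwa [← Int.cast_neg, neg_sub]))
        (evalPair_shiftedLoop c₁ c₂ _ _)
      rwa [residueForm_shiftedLoop, sub_sub_cancel] at h2
    have h3 := mem_weightFiltration_vertex_one_of_orthogonal h1
    rwa [show -(n - 1) - 1 = -n by ring, Int.cast_neg] at h3
  -- The cutoff is `2` because `F_(-n) = 0` for `n ≥ 2`; so `f` is a loop.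
  obtain ⟨φ, hφ, hφ0⟩ := exists_toFormalZero_coeff f 2
  have hφf (n : ℤ) : φ n = formalCoeff n f := by
    rcases lt_or_ge n 2 with hn | hn
    · exact hφ n hn
    · have h1 := hcoeff n
      rw [weightFiltration_vertex_one_eq_bot hθ hk, Submodule.mem_bot] at h1
      · rw [hφ0 n hn, h1]
      · have : (2 : ℝ) ≤ n := by exact_mod_cast hn
        linarith
  refine ⟨loopOfCoeff φ, loopOfCoeff_mem_orderLoopAlgebra.2 fun n => by rw [hφf]; exact hcoeff n,
    formal_ext fun n => ?_⟩
  rw [formalCoeff_toFormalZero_loopOfCoeff, hφf]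

/-- The principal part of `f` will do: negative powers of `u` carry no restriction, since `F_r` is
all of `𝔤` for `r ≥ 1`. -/
theorem exists_sub_mem_taylor (hθ : IsHighestRoot b θ) (hk : coeffSimple b α θ = 1)
    (f : Formal ℂ 𝔤) :
    ∃ d ∈ orderLoopAlgebra (vertex b α 1), f - toFormalZero ℂ 𝔤 d ∈ taylor ℂ 𝔤 := by
  obtain ⟨φ, hφ, hφ0⟩ := exists_toFormalZero_coeff f 0
  refine ⟨loopOfCoeff φ, loopOfCoeff_mem_orderLoopAlgebra.2 fun n => ?_,
    (mem_taylor_iff _).2 fun n hn => ?_⟩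
  · rcases lt_or_ge n 0 with hn | hn
    · rw [weightFiltration_vertex_one_eq_top hθ hk]
      · trivial
      · have : (n : ℝ) ≤ -1 := by exact_mod_cast Int.le_sub_one_of_lt hn
        linarith
    · rw [hφ0 n hn]; exact zero_mem _
  · rw [map_sub, formalCoeff_toFormalZero_loopOfCoeff, hφ n hn, sub_self]

/-- Only exponents `0` and `1` survive: `F_0` is the parabolic, `F_(-1)` its nilradical, and `F_(-n)
= 0` for `n ≥ 2`. -/
theorem mem_orderLoopAlgebra_and_taylor_iff (hθ : IsHighestRoot b θ) (hk : coeffSimple b α θ = 1)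
    (d : Loop ℂ 𝔤) :
    d ∈ orderLoopAlgebra (vertex b α 1) ∧ toFormalZero ℂ 𝔤 d ∈ taylor ℂ 𝔤 ↔
      ∃ p ∈ parabolic b α, ∃ n ∈ nilradical b α,
        d = LaurentPolynomial.T 0 ⊗ₜ[ℂ] p + LaurentPolynomial.T 1 ⊗ₜ[ℂ] n := by
  constructor
  · rintro ⟨hd, hdT⟩
    obtain ⟨φ, rfl⟩ := loopOfCoeff_surjective d
    rw [loopOfCoeff_mem_orderLoopAlgebra] at hd
    simp only [mem_taylor_iff, formalCoeff_toFormalZero_loopOfCoeff] at hdT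
    refine ⟨φ 0, ?_, φ 1, ?_, ?_⟩
    · rw [← weightFiltration_vertex_one_zero]; simpa using hd 0
    · rw [← weightFiltration_vertex_one_neg_one]; simpa using hd 1
    · rw [← loopOfCoeff_single, ← loopOfCoeff_single, ← map_add]
      congr 1
      ext n
      rw [Finsupp.add_apply]
      rcases lt_trichotomy n 0 with hn | rfl | hn
      · rw [hdT n hn, Finsupp.single_eq_of_ne (by lia), Finsupp.single_eq_of_ne (by lia), add_zero]
      · simp
      · by_cases hn1 : n = 1
        · subst hn1; simp
        · have h1 := hd n
          rw [weightFiltration_vertex_one_eq_bot hθ hk, Submodule.mem_bot] at h1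
          · rw [h1, Finsupp.single_eq_of_ne (by lia), Finsupp.single_eq_of_ne hn1, add_zero]
          · have : (2 : ℝ) ≤ n := by exact_mod_cast (show (2 : ℤ) ≤ n by lia)
            linarith
  · rintro ⟨p, hp, n, hn, rfl⟩
    refine ⟨add_mem (T_tmul_mem_orderLoopAlgebra ?_) (T_tmul_mem_orderLoopAlgebra ?_),
      (mem_taylor_iff _).2 fun m hm => ?_⟩
    · rw [← weightFiltration_vertex_one_zero] at hp; simpa using hp
    · rw [← weightFiltration_vertex_one_neg_one] at hn; simpa using hn
    · rw [map_add, map_add, formalCoeff_toFormalZero_T_tmul, formalCoeff_toFormalZero_T_tmul,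
        Finsupp.single_eq_of_ne (by lia), Finsupp.single_eq_of_ne (by lia), add_zero]

theorem mem_equalReductivePart_iff_exists_loop (hθ : IsHighestRoot b θ)
    (hk : coeffSimple b α θ = 1) {c₁ c₂ : ℂˣ} (hc : (c₁ : ℂ) ≠ c₂) (m : 𝔤 × 𝔤) :
    m ∈ equalReductivePart b α ↔ ∃ d ∈ orderLoopAlgebra (vertex b α 1),
      toFormalZero ℂ 𝔤 d ∈ taylor ℂ 𝔤 ∧ evalPair ℂ 𝔤 c₁ c₂ d = m := by
  rw [mem_equalReductivePart_iff]
  constructor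
  · rintro ⟨z, hz, h1, h2⟩
    have hc' : (c₁ : ℂ)⁻¹ - (c₂ : ℂ)⁻¹ ≠ 0 := sub_ne_zero.2 fun h => hc (inv_injective h)
    -- The values of `p + u y` at the poles are `p + cᵢ⁻¹ y`, so their difference determines `y`.
    set y : 𝔤 := ((c₁ : ℂ)⁻¹ - (c₂ : ℂ)⁻¹)⁻¹ • (m.1 - m.2) with hy
    have hy' : ((c₁ : ℂ)⁻¹ - (c₂ : ℂ)⁻¹) • y = m.1 - m.2 := by
      rw [hy, smul_smul, mul_inv_cancel₀ hc', one_smul]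
    have hyn : y ∈ nilradical b α := by
      refine Submodule.smul_mem _ _ ?_
      rw [← sub_sub_sub_cancel_right m.1 m.2 z]
      exact sub_mem h1 h2
    have hp : m.1 - (c₁ : ℂ)⁻¹ • y ∈ parabolic b α := by
      rw [parabolic_eq, show m.1 - (c₁ : ℂ)⁻¹ • y = z + ((m.1 - z) - (c₁ : ℂ)⁻¹ • y) by abel]
      exact add_mem (le_sup_left (a := levi b α) hz)
        (le_sup_right (a := levi b α) (sub_mem h1 (Submodule.smul_mem _ _ hyn)))
    obtain ⟨hd, hdT⟩ := (mem_orderLoopAlgebra_and_taylor_iff hθ hk _).2 ⟨_, hp, y, hyn, rfl⟩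
    refine ⟨_, hd, hdT, ?_⟩
    rw [evalPair_T_zero_add_T_one]
    refine Prod.ext (sub_add_cancel _ _) ?_
    rw [sub_smul] at hy'
    change m.1 - (c₁ : ℂ)⁻¹ • y + (c₂ : ℂ)⁻¹ • y = m.2
    rw [sub_add, hy', sub_sub_cancel]
  · rintro ⟨d, hd, hdT, rfl⟩
    obtain ⟨p, hp, n, hn, rfl⟩ := (mem_orderLoopAlgebra_and_taylor_iff hθ hk d).1 ⟨hd, hdT⟩
    rw [parabolic_eq] at hp
    obtain ⟨z, hz, n', hn', rfl⟩ := Submodule.mem_sup.1 hp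
    rw [evalPair_T_zero_add_T_one]
    have key (c : ℂ) : z + n' + c • n - z ∈ nilradical b α := by
      rw [add_assoc, add_sub_cancel_left]
      exact add_mem hn' (Submodule.smul_mem _ _ hn)
    exact ⟨z, hz, key _, key _⟩

theorem eq_zero_of_evalPair_eq_zero (hθ : IsHighestRoot b θ)
    (hk : coeffSimple b α θ = 1) {c₁ c₂ : ℂˣ} (hc : (c₁ : ℂ) ≠ c₂) {d : Loop ℂ 𝔤}
    (hd : d ∈ orderLoopAlgebra (vertex b α 1)) (hdT : toFormalZero ℂ 𝔤 d ∈ taylor ℂ 𝔤)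
    (hd0 : evalPair ℂ 𝔤 c₁ c₂ d = 0) : d = 0 := by
  obtain ⟨p, hp, n, hn, rfl⟩ := (mem_orderLoopAlgebra_and_taylor_iff hθ hk d).1 ⟨hd, hdT⟩
  rw [evalPair_T_zero_add_T_one, Prod.mk_eq_zero] at hd0
  obtain ⟨h1, h2⟩ := hd0
  have hc' : (c₁ : ℂ)⁻¹ - (c₂ : ℂ)⁻¹ ≠ 0 := sub_ne_zero.2 fun h => hc (inv_injective h)
  have h3 : ((c₁ : ℂ)⁻¹ - (c₂ : ℂ)⁻¹) • n = 0 := by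
    rw [sub_smul, ← add_sub_add_left_eq_sub _ _ p, h1, h2, sub_zero]
  have h4 : n = 0 := (smul_eq_zero.1 h3).resolve_left hc'
  rw [h4, smul_zero, add_zero] at h1
  rw [h1, h4, TensorProduct.tmul_zero, TensorProduct.tmul_zero, add_zero]

/-- If `k > 1`, then the orthogonal complement of `𝕆_α ∩ 𝔤[u, u⁻¹]` is not contained in it, so that
it contains no Lagrangian subalgebras. -/
theorem not_le_orderLoops_of_isLagrangian {k : ℤ} (hk : 1 < k) {c₁ c₂ : ℂ} (hc₁ : c₁ ≠ 0)
    (hc₂ : c₂ ≠ 0) {W : LieSubalgebra ℂ (Formal ℂ 𝔤)}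
    (hW : IsLagrangian (residueForm 𝔤 (aSeries c₁ c₂)) W) :
    ¬ W.toSubmodule ≤ orderLoops (vertex b α k) := by
  intro hWD
  rw [orderLoops_eq] at hWD
  have hk' : (1 : ℝ) < k := by exact_mod_cast hk
  have hα : ((LieAlgebra.IsKilling.rootSystem H).root α (vertex b α k)).re = 1 / k := by
    rw [re_root_vertex, coeffSimple_self, Int.cast_one]
  obtain ⟨x, hx, hx0⟩ := (α : H.root).1.exists_ne_zero
  have hxF : x ∈ weightFiltration (vertex b α k) (1 / k) :=
    rootSpace_le_weightFiltration _ (α : H.root) hα.le hx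
  -- The pairing only sees the coefficient of `u` in `w`, which is in `F_(-1)`; it vanishes because
  -- `1/k - 1 < 0`.
  have hz : toFormalZero ℂ 𝔤 (shiftedLoop c₁ c₂ 0 x) ∈ W := by
    rw [mem_iff_of_isLagrangian hW]
    intro w hw
    obtain ⟨d, hd, rfl⟩ := hWD hw
    rw [residueForm_comm, residueForm_shiftedLoop]
    refine killingForm_eq_zero_of_mem_weightFiltration _ ?_ hxF (hd (1 - 0))
    have : 1 / (k : ℝ) < 1 := (div_lt_one (by linarith)).2 hk'
    norm_num at this ⊢
    exact this
  obtain ⟨d, hd, hdz⟩ := hWD hz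
  obtain rfl := toFormalZero_injective hdz
  -- The constant coefficient is `c₁ c₂ x`, which would have to be in `F_0` although `α(h) = 1/k >
  -- 0`.
  have h0 := hd 0
  rw [shiftedLoop, map_add, map_sub, map_smul, map_smul, map_add, map_sub, map_smul, map_smul,
    formalCoeff_toFormalZero_T_tmul, formalCoeff_toFormalZero_T_tmul,
    formalCoeff_toFormalZero_T_tmul, Finsupp.single_eq_of_ne (by norm_num),
    Finsupp.single_eq_of_ne (by norm_num), Finsupp.single_eq_same, smul_zero, sub_zero, zero_add,
    Submodule.smul_mem_iff _ (mul_ne_zero hc₁ hc₂)] at h0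
  refine hx0 (eq_zero_of_mem_weightFiltration (vertex b α k) hx ?_ h0)
  change _ < ((LieAlgebra.IsKilling.rootSystem H).root α (vertex b α k)).re
  rw [hα, Int.cast_zero, neg_zero]
  positivity

end Main

end LoopLagrangian

end

theorem theorem2p3 {𝔤 : Type*} [LieRing 𝔤] [LieAlgebra ℂ 𝔤] [FiniteDimensional ℂ 𝔤]
    [LieAlgebra.IsSimple ℂ 𝔤] (H : LieSubalgebra ℂ 𝔤) [H.IsCartanSubalgebra]
    (b : (LieAlgebra.IsKilling.rootSystem H).Base) (θ : H.root)
    (hθ : LoopLagrangian.IsHighestRoot b θ) (α : b.support)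
    (k : ℤ) (hk : k = LoopLagrangian.coeffSimple b α θ)
    (c₁ c₂ : ℂ) (hc₁ : c₁ ≠ 0) (hc₂ : c₂ ≠ 0) (hc : c₁ ≠ c₂) :
    (k = 1 →
      Set.BijOn
        (fun W : LieSubalgebra ℂ (LoopLagrangian.Formal ℂ 𝔤) =>
          (W.comap (LoopLagrangian.toFormalZero ℂ 𝔤)).map
            (LoopLagrangian.evalPair ℂ 𝔤 (Units.mk0 c₁ hc₁) (Units.mk0 c₂ hc₂)))
        {W | W ∈ LoopLagrangian.transversalLagrangians
              (LoopLagrangian.residueForm 𝔤 (LoopLagrangian.aSeries c₁ c₂))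
              (LoopLagrangian.taylor ℂ 𝔤) ∧
            W.toSubmodule ≤ LoopLagrangian.orderLoops (LoopLagrangian.vertex b α k)}
        (LoopLagrangian.transversalLagrangians (LoopLagrangian.pairForm ℂ 𝔤)
          (LoopLagrangian.equalReductivePart b α))) ∧
    (1 < k →
      ¬ ∃ W : LieSubalgebra ℂ (LoopLagrangian.Formal ℂ 𝔤),
        W ∈ LoopLagrangian.transversalLagrangians
              (LoopLagrangian.residueForm 𝔤 (LoopLagrangian.aSeries c₁ c₂))
              (LoopLagrangian.taylor ℂ 𝔤) ∧
            W.toSubmodule ≤ LoopLagrangian.orderLoops (LoopLagrangian.vertex b α k)) := by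
  subst hk
  refine ⟨fun h1 => ?_, fun hk => ?_⟩
  · have hc' : ((Units.mk0 c₁ hc₁ : ℂˣ) : ℂ) ≠ (Units.mk0 c₂ hc₂ : ℂˣ) := hc
    rw [h1, LoopLagrangian.orderLoops_eq]
    exact LoopLagrangian.bijOn_transversalLagrangians _ LoopLagrangian.toFormalZero_injective _ _ _ _
      (inv_ne_zero (sub_ne_zero.2 hc')) _ _
      (fun _ hd _ hd' => LoopLagrangian.residueForm_eq_pairForm hc' hd hd')
      (LoopLagrangian.exists_evalPair_eq hθ h1 hc')
      (fun _ hf => LoopLagrangian.exists_mem_orderLoopAlgebra_of_orthogonal hθ h1 hf)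
      (LoopLagrangian.exists_sub_mem_taylor hθ h1)
      (LoopLagrangian.mem_equalReductivePart_iff_exists_loop hθ h1 hc')
      (fun _ hd hdT hd0 => LoopLagrangian.eq_zero_of_evalPair_eq_zero hθ h1 hc' hd hdT hd0)
  · rintro ⟨W, ⟨hW, -⟩, hWD⟩
    exact LoopLagrangian.not_le_orderLoops_of_isLagrangian hk hc₁ hc₂ hW hWD
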